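/- Let $J$ be a bounded Jacobi operator on $\ell^2=\ell^2(\{0,1,2,\dots\})$, i.e. the bounded operator whose matrix in the standard basis $(e_k)_{k\ge 0}$ is symmetric tridiagonal with real diagonal entries $\alpha_0,\alpha_1,\dots$ and positive off-diagonal entries $\beta_0,\beta_1,\dots$. Suppose that there is an integer $n\ge 1$ with $$\alpha_k=0,\qquad \beta_{k-1}=\tfrac12\qquad\text{for all } k\ge n,$$ i.e. $J$ equals the free Jacobi operator $\Delta$ (all diagonal entries $0$, all off-diagonal entries $\frac12$) outside the $n\times n$ principal submatrix. Let $P_0,P_1,\dots$ be the orthonormal polynomials of $J$, defined by $P_{-1}=0$, $P_0=1$ and $sP_k(s)=\beta_{k-1}P_{k-1}(s)+\alpha_kP_k(s)+\beta_kP_{k+1}(s)$, and let $U_0,U_1,\dots$ be those of $\Delta$ (the Chebyshev polynomials of the second kind). Let $(c_{ij})$ be the connection coefficients, $P_j=\sum_{i=0}^{j}c_{ij}U_i$, and put $$p_C(s)=\sum_{k=0}^{2n-1}c_{0k}P_k(s).$$ Let $G(\lambda)=\langle e_0,(J-\lambda)^{-1}e_0\rangle$ for $\lambda\notin\sigma(J)$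 be the principal resolvent. The spectral measure of $J$ is the unique compactly supported probability measure $\mu$ on $\mathbb R$ with $G(\lambda)=\int (s-\lambda)^{-1}\,d\mu(s)$ for all $\lambda\in\mathbb C\setminus\sigma(J)$. Let $d\mu_\Delta(s)=\frac2\pi\sqrt{1-s^2}\,ds$ on $[-1,1]$. Then the spectral measure of $J$ is $$\mu=\frac{1}{p_C}\,\mu_\Delta+\sum_{k=1}^{r}w_k\,\delta_{\lambda_k},$$ where $\lambda_1,\dots,\lambda_r$ are the distinct real roots $\lambda$ of $p_C$ in $\mathbb R\setminus\{1,-1\}$ for which the limit $\lim_{\epsilon\searrow0}\frac{\epsilon}{i}G(\lambda+i\epsilon)$ (which exists and is a nonnegative real number for every root of $p_C$ in $\mathbb R\setminus\{1,-1\}$) is nonzero, and $$w_k=\lim_{\epsilon\searrow0}\frac{\epsilon}{i}G(\lambda_k+i\epsilon)\neq0 .$$ Furthermore, $p_C$ has no roots in $(-1,1)$; and $\lambda_1,\dots,\lambda_r$ are exactly the eigenvalues of $J$, and $r\le n$. -/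

import Mathlib

noncomputable section

namespace Jacobi

open Polynomial

/-- The complex Hilbert space `ℓ²({0, 1, 2, …})`. -/
abbrev L2 : Type := lp (fun _ : ℕ => ℂ) 2

/-- The standard orthonormal basis vectors `e₀, e₁, e₂, …` of `ℓ²`. -/
def e (k : ℕ) : L2 := lp.single 2 k (1 : ℂ)

/-- The symmetric tridiagonal matrix with diagonal `α₀, α₁, …` and off-diagonal `β₀, β₁, …`. -/
def tridiagonal (α β : ℕ → ℝ) (i j : ℕ) : ℝ :=
  if i = j then α i else if j = i + 1 then β i else if i = j + 1 then β j else 0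

/-- `J` is the (bounded) Jacobi operator with diagonal entries `α k` and positive off-diagonal
entries `β k`: its matrix in the standard basis of `ℓ²` is the corresponding tridiagonal one. -/
structure IsJacobi (J : L2 →L[ℂ] L2) (α β : ℕ → ℝ) : Prop where
  pos : ∀ k, 0 < β k
  matrix : ∀ i j, inner ℂ (e i) (J (e j)) = ((tridiagonal α β i j : ℝ) : ℂ)

/-- The principal resolvent `G(z) = ⟨e₀, (J - z)⁻¹ e₀⟩`, meaningful for `z ∉ σ(J)`. -/
def principalResolvent (J : L2 →L[ℂ] L2) (z : ℂ) : ℂ :=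
  inner ℂ (e 0) (Ring.inverse (J - algebraMap ℂ (L2 →L[ℂ] L2) z) (e 0))

/-- `μ` is the spectral measure of `J`: a compactly supported probability measure on `ℝ` whose
Stieltjes transform is the principal resolvent of `J`. -/
structure IsSpectralMeasure (J : L2 →L[ℂ] L2) (μ : MeasureTheory.Measure ℝ) : Prop where
  prob : MeasureTheory.IsProbabilityMeasure μ
  compact_support : ∃ K : Set ℝ, IsCompact K ∧ μ Kᶜ = 0
  stieltjes : ∀ z : ℂ, z ∉ spectrum ℂ J → principalResolvent J z = ∫ s : ℝ, ((s : ℂ) - z)⁻¹ ∂μ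

/-- The orthonormal polynomials `P₀, P₁, …` attached to the recurrence coefficients `α`, `β`:
`P₀ = 1` and `s P_k = β_{k-1} P_{k-1} + α_k P_k + β_k P_{k+1}`, with `P_{-1} = 0`. -/
def orthoPoly (α β : ℕ → ℝ) : ℕ → ℝ[X]
  | 0 => 1
  | 1 => C (β 0)⁻¹ * (X - C (α 0))
  | k + 2 => C (β (k + 1))⁻¹ *
      ((X - C (α (k + 1))) * orthoPoly α β (k + 1) - C (β k) * orthoPoly α β k)

theorem degree_orthoPoly (α : ℕ → ℝ) {β : ℕ → ℝ} (hβ : ∀ k, 0 < β k) (k : ℕ) :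
    (orthoPoly α β k).degree = k := by
  induction k using Nat.strong_induction_on with
  | _ k ih =>
    match k with
    | 0 => simp [orthoPoly]
    | 1 =>
      rw [orthoPoly, degree_C_mul (inv_ne_zero (hβ 0).ne'), degree_X_sub_C]
      rfl
    | k + 2 =>
      have h1 := ih (k + 1) (by omega)
      have h0 := ih k (by omega)
      have hm : ((X - C (α (k + 1))) * orthoPoly α β (k + 1)).degree = ((k + 2 : ℕ) : WithBot ℕ) := by
        rw [degree_mul, degree_X_sub_C, h1]
        norm_cast
        omega
      rw [orthoPoly, degree_C_mul (inv_ne_zero (hβ _).ne'), degree_sub_eq_left_of_degree_lt, hm]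
      rw [hm, degree_C_mul (hβ k).ne', h0]
      norm_cast
      omega

/-- The orthonormal polynomials as a basis of `ℝ[X]`. -/
def orthoBasis (α : ℕ → ℝ) {β : ℕ → ℝ} (hβ : ∀ k, 0 < β k) : Module.Basis ℕ ℝ ℝ[X] :=
  Polynomial.Sequence.basis ⟨orthoPoly α β, degree_orthoPoly α hβ⟩
    (fun i => isUnit_iff_ne_zero.mpr
      (leadingCoeff_ne_zero.mpr (Polynomial.Sequence.ne_zero _ i)))

/-- The connection coefficient `c_{ij}` between the Jacobi operator with coefficients `α`, `β` and
the one with coefficients `γ`, `δ`: the coefficient of `Q_i` in the expansion of `P_j`, where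
`P` and `Q` are the respective orthonormal polynomials, `P_j = c_{0j} Q_0 + ⋯ + c_{jj} Q_j`. -/
def connectionCoeff (α β γ : ℕ → ℝ) {δ : ℕ → ℝ} (hδ : ∀ k, 0 < δ k) (i j : ℕ) : ℝ :=
  (orthoBasis γ hδ).repr (orthoPoly α β j) i

/-- Diagonal coefficients of the free Jacobi operator `Δ`. -/
def freeα : ℕ → ℝ := fun _ => 0

/-- Off-diagonal coefficients of the free Jacobi operator `Δ`. -/
def freeβ : ℕ → ℝ := fun _ => 1 / 2

theorem freeβ_pos (k : ℕ) : 0 < freeβ k := by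
  norm_num [freeβ]

/-- The polynomial `p_C = ∑_{k=0}^{2n-1} c_{0k} P_k`, with `C = (c_{ij})` the connection
coefficient matrix from the Jacobi operator with coefficients `α`, `β` to `Δ`. -/
def pC (α β : ℕ → ℝ) (n : ℕ) : ℝ[X] :=
  ∑ k ∈ Finset.range (2 * n), C (connectionCoeff α β freeα freeβ_pos 0 k) * orthoPoly α β k

/-- The semicircle measure `dμ_Δ(s) = (2/π) √(1 - s²) ds` on `[-1, 1]`. -/
def semicircle : MeasureTheory.Measure ℝ :=
  (MeasureTheory.volume.restrict (Set.Icc (-1) 1)).withDensity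
    (fun s => ENNReal.ofReal (2 / Real.pi * Real.sqrt (1 - s ^ 2)))

/-- The measure `μ_Δ / p + ∑_{x ∈ Λ} w_x δ_x`. The density `1/p` is taken in `[0, ∞]`, with value
`∞` at the points where `p ≤ 0`; so no negative part is cut off: such a measure can be finite only
if `p > 0` almost everywhere on `[-1, 1]`. -/
def candidateMeasure (p : ℝ[X]) (Λ : Finset ℝ) (w : ℝ → NNReal) : MeasureTheory.Measure ℝ :=
  semicircle.withDensity (fun s => (ENNReal.ofReal (p.eval s))⁻¹) +
    ∑ x ∈ Λ, (w x : ENNReal) • MeasureTheory.Measure.dirac x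

end Jacobi

end

/-!
A bounded Jacobi operator has a spectral measure `μ` at `e₀`, for which the polynomials `P_k` are
orthonormal. The whole formula is a consequence of one identity between signed measures,
`p_C μ = μ_Δ`.

It is checked on moments (`integral_mul_pC`). By orthonormality `∫ P_j p_C dμ` is `c_{0j}` for
`j < 2n` and `0` otherwise, while `∫ P_j dμ_Δ` is always the coefficient `c_{0j}` of `U_0` in `P_j`
(`integral_semicircle_eq_chebCoeff`). These agree because `c_{0j} = 0` for `j ≥ 2n`
(`chebCoeff_zero_orthoPoly_of_tail`): beyond the perturbed block the recurrence is the free one, so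
that `P_{n+j} = U_j P_n - U_{j-1} P_{n-1}`, and `⟨U_j P, 1⟩ = ⟨P, U_j⟩` vanishes when `deg P < j`.
At the last index `j = n` both terms are nonzero and cancel.

Since both `μ` and `μ_Δ` are positive, `p_C ≥ 0` holds `μ`-almost everywhere, and dividing by `p_C`
gives `μ = μ_Δ / p_C` up to point masses at the roots of `p_C`
(`eq_candidateMeasure_of_withDensity_eq`). A root `x` in `(-1, 1)` is impossible
(`not_isRoot_of_mem_Ioo`): the interval `(x, x + ε)` has `μ_Δ`-measure of order `ε`, but `p_C = O(ε)`
on it while its `μ`-measure tends to `0`.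

The weights are `w_x = μ {x}`, by dominated convergence in the Stieltjes transform
(`tendsto_mul_stieltjes`). The atoms of `μ` are the eigenvalues of `J`: at an atom Bessel's inequality
puts `(P_k(x))_k` in `ℓ²` (`summable_sq_eval_orthoPoly`), and conversely an eigenvector `u` has
`u_0 ≠ 0`, so that `μ {x} ≥ |u_0|² / ‖u‖² > 0` (`norm_inner_sq_le_measureReal_singleton`). The points
`±1` are not atoms since there the free recurrence has no decaying solution. Finally, more than `n`
eigenvectors would have a nontrivial combination supported off the perturbed block, where `J` is a
contraction, although all eigenvalues have modulus greater than `1`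
(`IsJacobi.card_eigenvalues_le`).

Existence of `μ` is the spectral theorem at a vector (`exists_spectralMeasure`), obtained from the
continuous functional calculus and the Riesz-Markov-Kakutani theorem. For its uniqueness the moments
are recovered from the Stieltjes transform (`measure_eq_of_stieltjes_eq`).
-/
noncomputable section

namespace Jacobi

open Polynomial

/-! ### Orthonormal polynomials and Chebyshev coefficients -/

theorem orthoBasis_apply (α : ℕ → ℝ) {β : ℕ → ℝ} (hβ : ∀ k, 0 < β k) (k : ℕ) :
    orthoBasis α hβ k = orthoPoly α β k := by
  simp only [orthoBasis, Polynomial.Sequence.basis_eq_self]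

theorem X_mul_orthoPoly_zero (α : ℕ → ℝ) {β : ℕ → ℝ} (hβ : ∀ k, 0 < β k) :
    X * orthoPoly α β 0 = C (α 0) * orthoPoly α β 0 + C (β 0) * orthoPoly α β 1 := by
  simp only [orthoPoly]
  rw [← mul_assoc, ← C_mul, mul_inv_cancel₀ (hβ 0).ne']
  simp

theorem X_mul_orthoPoly_succ (α : ℕ → ℝ) {β : ℕ → ℝ} (hβ : ∀ k, 0 < β k) (k : ℕ) :
    X * orthoPoly α β (k + 1) = C (β k) * orthoPoly α β k
      + C (α (k + 1)) * orthoPoly α β (k + 1) + C (β (k + 1)) * orthoPoly α β (k + 2) := by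
  rw [orthoPoly, ← mul_assoc (C (β (k + 1))), ← C_mul, mul_inv_cancel₀ (hβ _).ne', C_1]
  ring

/-- The coefficient of the Chebyshev polynomial `U_i` in the expansion of `p`. -/
def chebCoeff (i : ℕ) : ℝ[X] →ₗ[ℝ] ℝ :=
  Finsupp.lapply i ∘ₗ (orthoBasis freeα freeβ_pos).repr.toLinearMap

theorem connectionCoeff_free (α β : ℕ → ℝ) (i j : ℕ) :
    connectionCoeff α β freeα freeβ_pos i j = chebCoeff i (orthoPoly α β j) := rfl

theorem chebCoeff_orthoPoly_free (i j : ℕ) :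
    chebCoeff i (orthoPoly freeα freeβ j) = if j = i then 1 else 0 := by
  rw [← orthoBasis_apply freeα freeβ_pos]
  simp [chebCoeff, Finsupp.single_apply]

theorem chebCoeff_C_mul (i : ℕ) (a : ℝ) (p : ℝ[X]) :
    chebCoeff i (C a * p) = a * chebCoeff i p := by
  rw [← smul_eq_C_mul, map_smul, smul_eq_mul]

theorem linearMap_ext_orthoPoly (α : ℕ → ℝ) {β : ℕ → ℝ} (hβ : ∀ k, 0 < β k) {M : Type*}
    [AddCommGroup M] [Module ℝ M] {f g : ℝ[X] →ₗ[ℝ] M}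
    (h : ∀ k, f (orthoPoly α β k) = g (orthoPoly α β k)) : f = g :=
  (orthoBasis α hβ).ext fun k => by rw [orthoBasis_apply, h]

theorem chebCoeff_zero_X_mul (p : ℝ[X]) : chebCoeff 0 (X * p) = 1 / 2 * chebCoeff 1 p := by
  have h : chebCoeff 0 ∘ₗ LinearMap.mulLeft ℝ X = (1 / 2 : ℝ) • chebCoeff 1 := by
    refine linearMap_ext_orthoPoly freeα freeβ_pos fun k => ?_
    cases k with
    | zero =>
      simp [X_mul_orthoPoly_zero freeα freeβ_pos, chebCoeff_C_mul, chebCoeff_orthoPoly_free, freeα]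
    | succ k =>
      simp [X_mul_orthoPoly_succ freeα freeβ_pos, chebCoeff_C_mul, chebCoeff_orthoPoly_free, freeα,
        freeβ]
  simpa using LinearMap.congr_fun h p

theorem chebCoeff_succ_X_mul (i : ℕ) (p : ℝ[X]) :
    chebCoeff (i + 1) (X * p) = 1 / 2 * chebCoeff i p + 1 / 2 * chebCoeff (i + 2) p := by
  have h : chebCoeff (i + 1) ∘ₗ LinearMap.mulLeft ℝ X
      = (1 / 2 : ℝ) • chebCoeff i + (1 / 2 : ℝ) • chebCoeff (i + 2) := by
    refine linearMap_ext_orthoPoly freeα freeβ_pos fun k => ?_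
    cases k with
    | zero =>
      simp [X_mul_orthoPoly_zero freeα freeβ_pos, chebCoeff_C_mul, chebCoeff_orthoPoly_free, freeα,
        freeβ, eq_comm]
    | succ k =>
      simp [X_mul_orthoPoly_succ freeα freeβ_pos, chebCoeff_C_mul, chebCoeff_orthoPoly_free, freeα,
        freeβ]
      grind
  simpa using LinearMap.congr_fun h p

/-- `⟨U_j p, 1⟩ = ⟨p, U_j⟩`, read off algebraically. -/
theorem chebCoeff_zero_orthoPoly_free_mul (j : ℕ) (p : ℝ[X]) :
    chebCoeff 0 (orthoPoly freeα freeβ j * p) = chebCoeff j p := by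
  induction j using Nat.strong_induction_on generalizing p with
  | _ j ih =>
    match j with
    | 0 => simp [orthoPoly]
    | 1 =>
      simp only [orthoPoly, freeα, freeβ, C_0, sub_zero, mul_assoc, chebCoeff_C_mul,
        chebCoeff_zero_X_mul]
      ring
    | j + 2 =>
      have h1 := ih (j + 1) (by omega) (X * p)
      have h0 := ih j (by omega) p
      have e : orthoPoly freeα freeβ (j + 2) * p =
          C 2 * (orthoPoly freeα freeβ (j + 1) * (X * p)) - orthoPoly freeα freeβ j * p := by
        have h3 : C (2 : ℝ) * C (1 / 2 : ℝ) = 1 := by rw [← C_mul]; norm_num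
        have h4 : C ((1 / 2 : ℝ)⁻¹) = C 2 := by norm_num
        rw [orthoPoly, freeα, freeβ, h4, C_0, sub_zero]
        change _ = C 2 * (orthoPoly freeα freeβ (j + 1) * (X * p)) - orthoPoly freeα freeβ j * p
        change C 2 * (X * orthoPoly freeα freeβ (j + 1) - C (1 / 2) * orthoPoly freeα freeβ j) * p = _
        linear_combination (-orthoPoly freeα freeβ j * p) * h3
      rw [e, map_sub, chebCoeff_C_mul, h1, h0, chebCoeff_succ_X_mul]
      ring

theorem chebCoeff_orthoPoly_of_lt (α : ℕ → ℝ) {β : ℕ → ℝ} {i j : ℕ} (h : j < i) :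
    chebCoeff i (orthoPoly α β j) = 0 := by
  induction j using Nat.strong_induction_on generalizing i with
  | _ j ih =>
    obtain ⟨i, rfl⟩ : ∃ i', i = i' + 1 := ⟨i - 1, by omega⟩
    match j with
    | 0 =>
      have := chebCoeff_orthoPoly_free (i + 1) 0
      simpa [orthoPoly] using this
    | 1 =>
      have h1 : ∀ i, chebCoeff (i + 1) (1 : ℝ[X]) = 0 := fun i => by
        simpa [orthoPoly] using chebCoeff_orthoPoly_free (i + 1) 0
      have h2 : ∀ i, chebCoeff (i + 2) (X : ℝ[X]) = 0 := fun i => by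
        have := chebCoeff_succ_X_mul (i + 1) 1
        rw [h1, h1, mul_one] at this
        simpa using this
      obtain ⟨i, rfl⟩ : ∃ i', i = i' + 1 := ⟨i - 1, by omega⟩
      have h3 : chebCoeff (i + 2) (C (α 0)) = 0 := by
        rw [← mul_one (C (α 0)), chebCoeff_C_mul, h1, mul_zero]
      rw [orthoPoly, chebCoeff_C_mul, map_sub, h2, h3]
      simp
    | j + 2 =>
      have h1 := fun i (hi : j + 1 < i) => ih (j + 1) (by omega) hi
      have h0 := ih j (by omega) (i := i + 1) (by omega)
      rw [orthoPoly, chebCoeff_C_mul, map_sub, sub_mul, map_sub, chebCoeff_C_mul, chebCoeff_C_mul,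
        chebCoeff_succ_X_mul, h0, h1 _ (by omega), h1 _ (by omega), h1 _ (by omega)]
      simp

/-! ### Finiteness of the first row of connection coefficients -/

section Tail

variable {α β : ℕ → ℝ} {m : ℕ}

theorem orthoPoly_add_two_of_tail (hα : ∀ k, m + 1 ≤ k → α k = 0)
    (hβ : ∀ k, m ≤ k → β k = 1 / 2) {k : ℕ} (hk : m ≤ k) :
    orthoPoly α β (k + 2) = C 2 * (X * orthoPoly α β (k + 1)) - orthoPoly α β k := by
  have h3 : C (2 : ℝ) * C (1 / 2 : ℝ) = 1 := by rw [← C_mul]; norm_num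
  have h4 : C ((1 / 2 : ℝ)⁻¹) = C 2 := by norm_num
  rw [orthoPoly, hα (k + 1) (by omega), hβ (k + 1) (by omega), hβ k hk, h4]
  simp only [C_0, sub_zero]
  linear_combination (-orthoPoly α β k) * h3

/-- Where the recurrence is the free one, its solution is a combination of Chebyshev
polynomials. -/
theorem orthoPoly_eq_of_tail (hα : ∀ k, m + 1 ≤ k → α k = 0)
    (hβ : ∀ k, m ≤ k → β k = 1 / 2) (j : ℕ) :
    orthoPoly α β (m + 2 + j) = orthoPoly freeα freeβ (j + 1) * orthoPoly α β (m + 1)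
      - orthoPoly freeα freeβ j * orthoPoly α β m := by
  have h4 : C ((1 / 2 : ℝ)⁻¹) = C 2 := by norm_num
  have hf : ∀ k, orthoPoly freeα freeβ (k + 2) =
      C 2 * (X * orthoPoly freeα freeβ (k + 1)) - orthoPoly freeα freeβ k := fun k =>
    orthoPoly_add_two_of_tail (m := 0) (fun _ _ => rfl) (fun _ _ => rfl) (Nat.zero_le k)
  have hf1 : orthoPoly freeα freeβ 1 = C 2 * X := by
    rw [orthoPoly, freeα, freeβ, h4, C_0, sub_zero]
  have hf0 : orthoPoly freeα freeβ 0 = 1 := rfl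
  induction j using Nat.strong_induction_on with
  | _ j ih =>
    match j with
    | 0 =>
      rw [hf1, hf0, add_zero, orthoPoly_add_two_of_tail hα hβ le_rfl]
      ring
    | 1 =>
      have h0 := ih 0 (by omega)
      rw [show m + 2 + 1 = (m + 1) + 2 by ring, orthoPoly_add_two_of_tail hα hβ (by omega),
        show m + 1 + 1 = m + 2 + 0 by ring, h0, hf 0, zero_add, hf1, hf0]
      ring
    | j + 2 =>
      rw [show m + 2 + (j + 2) = (m + 2 + j) + 2 by ring,
        orthoPoly_add_two_of_tail hα hβ (by omega), ih j (by omega),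
        show m + 2 + j + 1 = m + 2 + (j + 1) by ring, ih (j + 1) (by omega), hf (j + 1), hf j]
      ring

/-- The first row of the connection coefficient matrix is finite. At the last index `2m + 2` the
two leading coefficients `c_{m+1,m+1}` and `c_{m,m}` cancel, because `β m` is already free. -/
theorem chebCoeff_zero_orthoPoly_of_tail (hα : ∀ k, m + 1 ≤ k → α k = 0)
    (hβ : ∀ k, m ≤ k → β k = 1 / 2) {k : ℕ} (hk : 2 * (m + 1) ≤ k) :
    chebCoeff 0 (orthoPoly α β k) = 0 := by
  obtain ⟨j, rfl⟩ : ∃ j, k = m + 2 + j := ⟨k - (m + 2), by omega⟩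
  rw [orthoPoly_eq_of_tail hα hβ, map_sub, chebCoeff_zero_orthoPoly_free_mul,
    chebCoeff_zero_orthoPoly_free_mul]
  rcases eq_or_lt_of_le (show m ≤ j by omega) with rfl | h
  · have h4 : C ((1 / 2 : ℝ)⁻¹) = C 2 := by norm_num
    rw [sub_eq_zero]
    match m, hα, hβ with
    | 0, hα, hβ =>
      have := chebCoeff_succ_X_mul 0 1
      have h0 := chebCoeff_orthoPoly_of_lt α (β := β) (i := 1) (j := 0) (by omega)
      have h1 := chebCoeff_orthoPoly_of_lt α (β := β) (i := 2) (j := 0) (by omega)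
      simp only [orthoPoly] at h0 h1
      simp only [orthoPoly, zero_add]
      rw [mul_one, h1] at this
      rw [chebCoeff_C_mul, hβ 0 le_rfl, map_sub, ← mul_one (C (α 0)), chebCoeff_C_mul, h0, this]
      norm_num
      ring
    | m + 1, hα, hβ =>
      rw [orthoPoly, chebCoeff_C_mul, map_sub, sub_mul, map_sub, chebCoeff_C_mul, chebCoeff_C_mul,
        chebCoeff_succ_X_mul, hβ (m + 1) le_rfl,
        chebCoeff_orthoPoly_of_lt α (show m + 1 < m + 1 + 1 by omega),
        chebCoeff_orthoPoly_of_lt α (show m + 1 < m + 1 + 2 by omega),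
        chebCoeff_orthoPoly_of_lt α (show m < m + 1 + 1 by omega)]
      ring
  · rw [chebCoeff_orthoPoly_of_lt α (by omega), chebCoeff_orthoPoly_of_lt α h, sub_zero]

end Tail

open MeasureTheory Filter Topology

/-! ### Compactly supported measures and their moments -/

section Moments

theorem exists_support_subset_Icc {μ : Measure ℝ} (h : ∃ K : Set ℝ, IsCompact K ∧ μ Kᶜ = 0) :
    ∃ R : ℝ, 0 < R ∧ ∀ᵐ s ∂μ, s ∈ Set.Icc (-R) R := by
  obtain ⟨K, hK, h0⟩ := h
  obtain ⟨R, hR, hKR⟩ := hK.isBounded.subset_closedBall_lt 0 0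
  refine ⟨R, hR, ?_⟩
  filter_upwards [compl_mem_ae_iff.mpr h0] with s hs
  have := hKR (by simpa using hs)
  rwa [Real.closedBall_eq_Icc, zero_sub, zero_add] at this

theorem integrable_of_ae_mem_Icc {E : Type*} [NormedAddCommGroup E] {μ : Measure ℝ}
    [IsFiniteMeasure μ] {R : ℝ} (hμ : ∀ᵐ s ∂μ, s ∈ Set.Icc (-R) R) {f : ℝ → E}
    (hf : ContinuousOn f (Set.Icc (-R) R)) : Integrable f μ := by
  have := hf.integrableOn_compact (μ := μ) isCompact_Icc
  rwa [IntegrableOn, Measure.restrict_eq_self_of_ae_mem hμ] at this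

/-- The Hausdorff moment problem is determinate: a finite measure on a bounded interval is
determined by the integrals of polynomials, by Weierstrass approximation. -/
theorem measure_eq_of_integral_polynomial_eq {μ ν : Measure ℝ} [IsFiniteMeasure μ]
    [IsFiniteMeasure ν] {R : ℝ} (hμ : ∀ᵐ s ∂μ, s ∈ Set.Icc (-R) R)
    (hν : ∀ᵐ s ∂ν, s ∈ Set.Icc (-R) R)
    (h : ∀ p : ℝ[X], ∫ s, p.eval s ∂μ = ∫ s, p.eval s ∂ν) : μ = ν := by
  refine ext_of_forall_integral_eq_of_IsFiniteMeasure fun f => ?_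
  have close : ∀ (ρ : Measure ℝ) [IsFiniteMeasure ρ], (∀ᵐ s ∂ρ, s ∈ Set.Icc (-R) R) →
      ∀ (p : ℝ[X]) (ε : ℝ), (∀ s ∈ Set.Icc (-R) R, |p.eval s - f s| < ε) →
      |∫ s, p.eval s ∂ρ - ∫ s, f s ∂ρ| ≤ ε * ρ.real Set.univ := by
    intro ρ _ hρ p ε hp
    rw [← integral_sub (integrable_of_ae_mem_Icc hρ p.continuous.continuousOn)
      (integrable_of_ae_mem_Icc hρ f.continuous.continuousOn)]
    rw [← Real.norm_eq_abs]
    refine norm_integral_le_of_norm_le_const ?_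
    filter_upwards [hρ] with s hs using (hp s hs).le
  refine eq_of_forall_dist_le fun ε hε => ?_
  set M := μ.real Set.univ + ν.real Set.univ + 1 with hM
  have hMpos : 0 < M := by positivity
  obtain ⟨p, hp⟩ := exists_polynomial_near_of_continuousOn (-R) R f f.continuous.continuousOn
    (ε / M) (by positivity)
  have h1 := close μ hμ p _ hp
  have h2 := close ν hν p _ hp
  rw [h p] at h1
  rw [Real.dist_eq]
  calc |∫ s, f s ∂μ - ∫ s, f s ∂ν|
      ≤ |∫ s, p.eval s ∂ν - ∫ s, f s ∂μ| + |∫ s, p.eval s ∂ν - ∫ s, f s ∂ν| := by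
        rw [abs_sub_comm (∫ s, p.eval s ∂ν) (∫ s, f s ∂μ)]
        exact abs_sub_le _ _ _
    _ ≤ ε / M * M := by nlinarith [div_pos hε hMpos]
    _ = ε := div_mul_cancel₀ _ hMpos.ne'

end Moments

/-! ### The Stieltjes transform -/

section Stieltjes

theorem tendsto_integral_pow_mul_inv {μ : Measure ℝ} [IsFiniteMeasure μ] {R : ℝ}
    (hμ : ∀ᵐ s ∂μ, s ∈ Set.Icc (-R) R) (k : ℕ) :
    Tendsto (fun y : ℝ => ∫ s : ℝ, (s : ℂ) ^ k * ((s : ℂ) - Complex.I * y)⁻¹ ∂μ) atTop (𝓝 0) := by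
  have hb : ∀ y : ℝ, 0 < y → ‖∫ s : ℝ, (s : ℂ) ^ k * ((s : ℂ) - Complex.I * y)⁻¹ ∂μ‖
      ≤ R ^ k * μ.real Set.univ * y⁻¹ := by
    intro y hy
    have : R ^ k * μ.real Set.univ * y⁻¹ = R ^ k * y⁻¹ * μ.real Set.univ := by ring
    rw [this]
    refine norm_integral_le_of_norm_le_const ?_
    filter_upwards [hμ] with s hs
    have h1 : |s| ≤ R := abs_le.mpr ⟨hs.1, hs.2⟩
    have hR : 0 ≤ R := (abs_nonneg s).trans h1
    rw [norm_mul, norm_pow, norm_inv, Complex.norm_real, Real.norm_eq_abs]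
    have h2 : y ≤ ‖(s : ℂ) - Complex.I * y‖ := by
      have := Complex.abs_im_le_norm ((s : ℂ) - Complex.I * y)
      simp at this
      rwa [abs_of_pos hy] at this
    gcongr
  refine squeeze_zero_norm' ((eventually_gt_atTop 0).mono fun y hy => hb y hy) ?_
  simpa using tendsto_inv_atTop_zero.const_mul (R ^ k * μ.real Set.univ)

theorem ofReal_sub_ne_zero_of_im {s : ℝ} {z : ℂ} (hz : z.im ≠ 0) : (s : ℂ) - z ≠ 0 := by
  intro h
  apply hz
  rw [← sub_eq_zero.mp h, Complex.ofReal_im]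

theorem continuous_pow_mul_inv_sub (k : ℕ) {z : ℂ} (hz : z.im ≠ 0) :
    Continuous fun s : ℝ => (s : ℂ) ^ k * ((s : ℂ) - z)⁻¹ := by
  refine Continuous.mul (by fun_prop) (Continuous.inv₀ (by fun_prop) fun s => ?_)
  exact ofReal_sub_ne_zero_of_im hz

theorem integral_pow_succ_mul_inv {μ : Measure ℝ} [IsFiniteMeasure μ] {R : ℝ}
    (hμ : ∀ᵐ s ∂μ, s ∈ Set.Icc (-R) R) (k : ℕ) {z : ℂ} (hz : z.im ≠ 0) :
    ∫ s : ℝ, (s : ℂ) ^ (k + 1) * ((s : ℂ) - z)⁻¹ ∂μ =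
      ∫ s : ℝ, (s : ℂ) ^ k ∂μ + z * ∫ s : ℝ, (s : ℂ) ^ k * ((s : ℂ) - z)⁻¹ ∂μ := by
  rw [← integral_const_mul, ← integral_add]
  · congr 1 with s
    have := ofReal_sub_ne_zero_of_im (s := s) hz
    field_simp
    ring
  · exact integrable_of_ae_mem_Icc hμ (by fun_prop)
  · exact (integrable_of_ae_mem_Icc hμ (continuous_pow_mul_inv_sub k hz).continuousOn).const_mul z

/-- The Stieltjes transform determines a compactly supported measure: all functions
`∫ s^k / (s - z) dμ(s)` and all moments can be recovered from it by induction on `k`, since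
`∫ s^k dμ = ∫ s^(k+1) / (s - z) dμ - z ∫ s^k / (s - z) dμ` and the first term on the right vanishes
as `z → ∞`. -/
theorem measure_eq_of_stieltjes_eq {μ ν : Measure ℝ} [IsFiniteMeasure μ]
    [IsFiniteMeasure ν] {R : ℝ} (hμ : ∀ᵐ s ∂μ, s ∈ Set.Icc (-R) R)
    (hν : ∀ᵐ s ∂ν, s ∈ Set.Icc (-R) R)
    (h : ∀ z : ℂ, z.im ≠ 0 → ∫ s : ℝ, ((s : ℂ) - z)⁻¹ ∂μ = ∫ s : ℝ, ((s : ℂ) - z)⁻¹ ∂ν) :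
    μ = ν := by
  -- the moment of order `k` is a limit of values of `∫ s^k / (s - z) dρ(s)`
  have mom : ∀ (ρ : Measure ℝ) [IsFiniteMeasure ρ], (∀ᵐ s ∂ρ, s ∈ Set.Icc (-R) R) → ∀ k : ℕ,
      Tendsto (fun y : ℝ => -(Complex.I * y *
        ∫ s : ℝ, (s : ℂ) ^ k * ((s : ℂ) - Complex.I * y)⁻¹ ∂ρ)) atTop
        (𝓝 (∫ s : ℝ, (s : ℂ) ^ k ∂ρ)) := by
    intro ρ _ hρ k
    have := (tendsto_const_nhds (x := ∫ s : ℝ, (s : ℂ) ^ k ∂ρ)).sub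
      (tendsto_integral_pow_mul_inv hρ (k + 1))
    rw [sub_zero] at this
    refine this.congr' ?_
    filter_upwards [eventually_gt_atTop 0] with y hy
    rw [integral_pow_succ_mul_inv hρ k (by simpa using hy.ne')]
    ring
  have step : ∀ k : ℕ, (∀ z : ℂ, z.im ≠ 0 → ∫ s : ℝ, (s : ℂ) ^ k * ((s : ℂ) - z)⁻¹ ∂μ =
      ∫ s : ℝ, (s : ℂ) ^ k * ((s : ℂ) - z)⁻¹ ∂ν) →
      ∫ s : ℝ, (s : ℂ) ^ k ∂μ = ∫ s : ℝ, (s : ℂ) ^ k ∂ν := by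
    intro k hk
    refine tendsto_nhds_unique ((mom μ hμ k).congr' ?_) (mom ν hν k)
    filter_upwards [eventually_gt_atTop 0] with y hy
    rw [hk _ (by simpa using hy.ne')]
  have all : ∀ k : ℕ, ∀ z : ℂ, z.im ≠ 0 → ∫ s : ℝ, (s : ℂ) ^ k * ((s : ℂ) - z)⁻¹ ∂μ =
      ∫ s : ℝ, (s : ℂ) ^ k * ((s : ℂ) - z)⁻¹ ∂ν := by
    intro k
    induction k with
    | zero => simpa using h
    | succ k ih =>
      intro z hz
      rw [integral_pow_succ_mul_inv hμ k hz, integral_pow_succ_mul_inv hν k hz, ih z hz, step k ih]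
  refine measure_eq_of_integral_polynomial_eq hμ hν fun p => ?_
  have hk : ∀ k : ℕ, ∫ s : ℝ, s ^ k ∂μ = ∫ s : ℝ, s ^ k ∂ν := by
    intro k
    have := step k (all k)
    simp only [← Complex.ofReal_pow] at this
    rw [integral_complex_ofReal, integral_complex_ofReal] at this
    exact_mod_cast this
  simp only [eval_eq_sum_range]
  rw [integral_finsetSum, integral_finsetSum]
  · simp only [integral_const_mul, hk]
  · exact fun k _ => integrable_of_ae_mem_Icc hν (by fun_prop)
  · exact fun k _ => integrable_of_ae_mem_Icc hμ (by fun_prop)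

/-- The point masses of a measure are recovered from its Stieltjes transform. -/
theorem tendsto_mul_stieltjes {μ : Measure ℝ} [IsFiniteMeasure μ] (x : ℝ) :
    Tendsto (fun ε : ℝ => (ε : ℂ) / Complex.I *
        ∫ s : ℝ, ((s : ℂ) - ((x : ℂ) + Complex.I * (ε : ℂ)))⁻¹ ∂μ)
      (𝓝[>] 0) (𝓝 ((μ.real {x} : ℝ) : ℂ)) := by
  have hlim : ((μ.real {x} : ℝ) : ℂ) = ∫ s : ℝ, Set.indicator {x} (fun _ => (1 : ℂ)) s ∂μ := by
    rw [integral_indicator_const _ (measurableSet_singleton x)]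
    simp
  rw [hlim]
  simp only [← integral_const_mul]
  refine tendsto_integral_filter_of_dominated_convergence (fun _ => 1) ?_ ?_
    (integrable_const 1) ?_
  · refine Eventually.of_forall fun ε => Measurable.aestronglyMeasurable ?_
    fun_prop
  · filter_upwards [self_mem_nhdsWithin] with ε (hε : 0 < ε)
    refine Eventually.of_forall fun s => ?_
    have h2 : ε ≤ ‖(s : ℂ) - ((x : ℂ) + Complex.I * (ε : ℂ))‖ := by
      have := Complex.abs_im_le_norm ((s : ℂ) - ((x : ℂ) + Complex.I * (ε : ℂ)))
      simp at this
      rwa [abs_of_pos hε] at this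
    rw [norm_mul, norm_div, Complex.norm_I, div_one, Complex.norm_real, Real.norm_eq_abs,
      abs_of_pos hε, norm_inv, ← div_eq_mul_inv]
    exact div_le_one_of_le₀ h2 (norm_nonneg _)
  · refine Eventually.of_forall fun s => ?_
    by_cases hs : s = x
    · subst hs
      refine tendsto_const_nhds.congr' ?_
      filter_upwards [self_mem_nhdsWithin] with ε (hε : 0 < ε)
      have : (ε : ℂ) ≠ 0 := by exact_mod_cast hε.ne'
      have hI : Complex.I ≠ 0 := Complex.I_ne_zero
      simp only [Set.mem_singleton_iff, Set.indicator_of_mem]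
      rw [show (s : ℂ) - (s + Complex.I * ε) = -(Complex.I * ε) by ring]
      field_simp
      rw [Complex.I_sq]
    · rw [Set.indicator_of_notMem (by simpa using hs)]
      have h0 : (s : ℂ) - (x + Complex.I * (0 : ℝ)) ≠ 0 := by
        simpa [sub_eq_zero] using hs
      have : ContinuousAt (fun ε : ℝ => (ε : ℂ) / Complex.I *
          ((s : ℂ) - ((x : ℂ) + Complex.I * (ε : ℂ)))⁻¹) 0 :=
        ContinuousAt.mul (by fun_prop) (ContinuousAt.inv₀ (by fun_prop) h0)
      have h := this.tendsto
      simp only [Complex.ofReal_zero, zero_div, zero_mul] at h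
      exact h.mono_left nhdsWithin_le_nhds

end Stieltjes

/-! ### The semicircle measure -/

section Semicircle

theorem semicircle_ae_mem : ∀ᵐ s ∂semicircle, s ∈ Set.Icc (-1 : ℝ) 1 :=
  (withDensity_absolutelyContinuous _ _).ae_le (ae_restrict_mem measurableSet_Icc)

instance : IsFiniteMeasure semicircle := by
  refine isFiniteMeasure_withDensity_ofReal ?_
  exact (ContinuousOn.integrableOn_compact isCompact_Icc (by fun_prop)).2

instance : NullSingletonClass semicircle :=
  ⟨fun _ => (withDensity_absolutelyContinuous _ _) (measure_singleton _)⟩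

theorem integral_semicircle (f : ℝ → ℝ) :
    ∫ s, f s ∂semicircle =
      2 / Real.pi * ∫ θ in (0 : ℝ)..Real.pi, f (Real.cos θ) * Real.sin θ ^ 2 := by
  have h0 : ∀ θ : ℝ, f (Real.cos θ) * Real.sin θ ^ 2 =
      (fun s => f s * (1 - s ^ 2)) (Real.cos θ) := fun θ => by
    simp only [← Real.sin_sq]
  rw [intervalIntegral.integral_congr fun θ _ => h0 θ,
    ← Chebyshev.integral_measureT_eq_integral_cos (f := fun s => f s * (1 - s ^ 2)),
    Chebyshev.integral_measureT, semicircle,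
    integral_withDensity_eq_integral_toReal_smul (by fun_prop) (by simp),
    intervalIntegral.integral_of_le (by norm_num), ← integral_Icc_eq_integral_Ioc,
    ← integral_const_mul]
  refine setIntegral_congr_fun measurableSet_Icc fun s hs => ?_
  have h1 : 0 ≤ 1 - s ^ 2 := by nlinarith [hs.1, hs.2]
  have h2 : (1 - s ^ 2) * √((1 - s ^ 2)⁻¹) = √(1 - s ^ 2) := by
    rcases h1.eq_or_lt with h | h
    · simp [← h]
    · have := Real.sqrt_ne_zero'.mpr h
      rw [Real.sqrt_inv]
      nth_rewrite 1 [← Real.sq_sqrt h1]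
      field_simp
  rw [ENNReal.toReal_ofReal (by positivity), smul_eq_mul, mul_assoc (f s), h2]
  ring

theorem eval_cos_orthoPoly_free_mul_sin (k : ℕ) (θ : ℝ) :
    (orthoPoly freeα freeβ k).eval (Real.cos θ) * Real.sin θ = Real.sin ((k + 1) * θ) := by
  induction k using Nat.strong_induction_on with
  | _ k ih =>
    match k with
    | 0 => simp [orthoPoly]
    | 1 =>
      simp only [orthoPoly, freeα, freeβ]
      norm_num
      rw [Real.sin_two_mul]
      ring
    | k + 2 =>
      have h1 := ih (k + 1) (by omega)
      have h0 := ih k (by omega)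
      rw [orthoPoly_add_two_of_tail (α := freeα) (β := freeβ) (m := 0) (fun _ _ => rfl)
        (fun _ _ => rfl) (Nat.zero_le k)]
      simp only [eval_sub, eval_mul, eval_C, eval_X, sub_mul]
      rw [h0]
      have e : 2 * (Real.cos θ * (orthoPoly freeα freeβ (k + 1)).eval (Real.cos θ)) * Real.sin θ
          = 2 * Real.cos θ * Real.sin (((k + 1 : ℕ) + 1) * θ) := by rw [← h1]; ring
      rw [e]
      push_cast
      rw [show ((k : ℝ) + 2 + 1) * θ = (k + 1 + 1) * θ + θ by ring,
        show ((k : ℝ) + 1) * θ = (k + 1 + 1) * θ - θ by ring, Real.sin_add, Real.sin_sub]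
      ring

theorem integral_orthoPoly_free_semicircle (k : ℕ) :
    ∫ s, (orthoPoly freeα freeβ k).eval s ∂semicircle = if k = 0 then 1 else 0 := by
  rw [integral_semicircle]
  have h : ∀ θ : ℝ, (orthoPoly freeα freeβ k).eval (Real.cos θ) * Real.sin θ ^ 2 =
      1 / 2 * (Real.cos (k * θ) - Real.cos (((k : ℝ) + 2) * θ)) := fun θ => by
    rw [pow_two, ← mul_assoc, eval_cos_orthoPoly_free_mul_sin,
      show (k : ℝ) * θ = (k + 1) * θ - θ by ring,
      show ((k : ℝ) + 2) * θ = (k + 1) * θ + θ by ring, Real.cos_sub, Real.cos_add]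
    ring
  have hc : ∀ j : ℕ, ∫ θ in (0 : ℝ)..Real.pi, Real.cos (j * θ) = if j = 0 then Real.pi else 0 := by
    intro j
    split_ifs with hj
    · simp [hj]
    · have : (j : ℝ) ≠ 0 := by exact_mod_cast hj
      rw [intervalIntegral.integral_comp_mul_left (fun t => Real.cos t) this, integral_cos]
      simp
  simp only [h]
  rw [intervalIntegral.integral_const_mul, intervalIntegral.integral_sub
    (Continuous.intervalIntegrable (by fun_prop) _ _)
    (Continuous.intervalIntegrable (by fun_prop) _ _), hc]
  have h2 := hc (k + 2)
  push_cast at h2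
  rw [h2]
  have := Real.pi_ne_zero
  rcases eq_or_ne k 0 with rfl | hk
  · norm_num
    field_simp
  · simp [hk]

/-- The semicircle measure is the one for which the Chebyshev polynomials are orthonormal. -/
theorem integral_semicircle_eq_chebCoeff (p : ℝ[X]) :
    ∫ s, p.eval s ∂semicircle = chebCoeff 0 p := by
  have hint : ∀ q : ℝ[X], Integrable (fun s => q.eval s) semicircle := fun q =>
    integrable_of_ae_mem_Icc semicircle_ae_mem q.continuous.continuousOn
  let f : ℝ[X] →ₗ[ℝ] ℝ :=
    { toFun := fun q => ∫ s, q.eval s ∂semicircle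
      map_add' := fun q r => by simp only [eval_add]; exact integral_add (hint q) (hint r)
      map_smul' := fun a q => by simp [integral_const_mul] }
  have : f = chebCoeff 0 := linearMap_ext_orthoPoly freeα freeβ_pos fun k => by
    rw [chebCoeff_orthoPoly_free]
    exact integral_orthoPoly_free_semicircle k
  exact LinearMap.congr_fun this p

theorem ofReal_mul_le_semicircle {a b c : ℝ} (hab : Set.Ioo a b ⊆ Set.Icc (-1) 1)
    (hc : ∀ s ∈ Set.Ioo a b, c ≤ 2 / Real.pi * √(1 - s ^ 2)) :
    ENNReal.ofReal c * ENNReal.ofReal (b - a) ≤ semicircle (Set.Ioo a b) := by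
  rw [semicircle, withDensity_apply _ measurableSet_Ioo, Measure.restrict_restrict
    measurableSet_Ioo, Set.inter_eq_left.mpr hab, ← Real.volume_Ioo, ← setLIntegral_const]
  exact setLIntegral_mono' measurableSet_Ioo fun s hs => ENNReal.ofReal_le_ofReal (hc s hs)

end Semicircle

/-! ### Division of the semicircle measure by a polynomial -/

section Division

variable {μ : Measure ℝ} {R : ℝ} {p : ℝ[X]}

theorem integral_withDensity_ofReal_eval (q : ℝ[X]) (f : ℝ → ℝ) :
    ∫ s, f s ∂(μ.withDensity fun s => ENNReal.ofReal (q.eval s)) =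
      ∫ s, max (q.eval s) 0 * f s ∂μ := by
  rw [integral_withDensity_eq_integral_toReal_smul (by fun_prop) (by simp)]
  simp only [ENNReal.toReal_ofReal', smul_eq_mul]

theorem isFiniteMeasure_withDensity_ofReal_eval [IsFiniteMeasure μ]
    (hμ : ∀ᵐ s ∂μ, s ∈ Set.Icc (-R) R) (q : ℝ[X]) :
    IsFiniteMeasure (μ.withDensity fun s => ENNReal.ofReal (q.eval s)) :=
  isFiniteMeasure_withDensity_ofReal (integrable_of_ae_mem_Icc hμ q.continuous.continuousOn).2

/-- A relation `p μ = μ_Δ` between moments, with `p` of unknown sign, is an equality of positive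
measures `p⁺ μ = μ_Δ`, and `p⁻ μ = 0`. -/
theorem withDensity_eq_semicircle [IsFiniteMeasure μ] (hμ : ∀ᵐ s ∂μ, s ∈ Set.Icc (-R) R)
    (h : ∀ q : ℝ[X], ∫ s, q.eval s * p.eval s ∂μ = ∫ s, q.eval s ∂semicircle) :
    μ {s | p.eval s < 0} = 0 ∧
      (μ.withDensity fun s => ENNReal.ofReal (p.eval s)) = semicircle := by
  set ν := μ.withDensity fun s => ENNReal.ofReal ((-p).eval s) with hν
  have hfin1 := isFiniteMeasure_withDensity_ofReal_eval hμ p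
  have hfin2 : IsFiniteMeasure ν := isFiniteMeasure_withDensity_ofReal_eval hμ (-p)
  have hμ' : ∀ᵐ s ∂μ, s ∈ Set.Icc (-(max R 1)) (max R 1) := by
    filter_upwards [hμ] with s hs
    exact Set.Icc_subset_Icc (neg_le_neg (le_max_left _ _)) (le_max_left _ _) hs
  have hν' : ∀ᵐ s ∂ν, s ∈ Set.Icc (-(max R 1)) (max R 1) :=
    (withDensity_absolutelyContinuous _ _).ae_le hμ'
  have hs' : ∀ᵐ s ∂semicircle, s ∈ Set.Icc (-(max R 1)) (max R 1) := by
    filter_upwards [semicircle_ae_mem] with s hs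
    exact Set.Icc_subset_Icc (neg_le_neg (le_max_right _ _)) (le_max_right _ _) hs
  -- `p = p⁺ - p⁻`, so that the relation between moments reads `p⁺ μ = p⁻ μ + μ_Δ`
  have key : (μ.withDensity fun s => ENNReal.ofReal (p.eval s)) = ν + semicircle := by
    refine measure_eq_of_integral_polynomial_eq (R := max R 1)
      ((withDensity_absolutelyContinuous _ _).ae_le hμ') (ae_add_measure_iff.mpr ⟨hν', hs'⟩)
      fun q => ?_
    rw [integral_add_measure (integrable_of_ae_mem_Icc hν' q.continuous.continuousOn)
      (integrable_of_ae_mem_Icc hs' q.continuous.continuousOn), ← h q, hν,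
      integral_withDensity_ofReal_eval, integral_withDensity_ofReal_eval, ← integral_add]
    · congr 1 with s
      rw [eval_neg]
      rcases le_total (p.eval s) 0 with h0 | h0
      · rw [max_eq_right h0, max_eq_left (by linarith)]; ring
      · rw [max_eq_left h0, max_eq_right (by linarith)]; ring
    · exact integrable_of_ae_mem_Icc hμ (by fun_prop)
    · exact integrable_of_ae_mem_Icc hμ (by fun_prop)
  have hN : MeasurableSet {s | p.eval s < 0} := measurableSet_lt (by fun_prop) (by fun_prop)
  have h0 : (μ.withDensity fun s => ENNReal.ofReal (p.eval s)) {s | p.eval s < 0} = 0 := by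
    rw [withDensity_apply _ hN, setLIntegral_congr_fun hN (g := fun _ => 0)]
    · simp
    · intro s (hs : p.eval s < 0)
      simp [hs.le]
  have h1 : ν {s | p.eval s < 0} = 0 := by
    rw [key, Measure.add_apply] at h0
    exact (add_eq_zero.mp h0).1
  have h2 : μ {s | p.eval s < 0} = 0 := by
    rw [hν, withDensity_apply_eq_zero (by fun_prop)] at h1
    convert h1 using 2
    ext s
    simp
  refine ⟨h2, ?_⟩
  -- `p⁻` is supported on `{p < 0}`, which is a null set
  have h3 : ν = 0 := by
    rw [hν, withDensity_eq_zero_iff (by fun_prop)]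
    filter_upwards [measure_eq_zero_iff_ae_notMem.mp h2] with s hs
    simpa using hs
  rw [key, h3, zero_add]

theorem withDensity_inv_eq_restrict
    (hp : (μ.withDensity fun s => ENNReal.ofReal (p.eval s)) = semicircle) :
    (semicircle.withDensity fun s => (ENNReal.ofReal (p.eval s))⁻¹) =
      μ.restrict {s | 0 < p.eval s} := by
  have hN : MeasurableSet {s | 0 < p.eval s} := measurableSet_lt (by fun_prop) (by fun_prop)
  rw [← hp, ← withDensity_mul _ (by fun_prop) (by fun_prop), ← withDensity_indicator_one hN]
  congr 1 with s
  by_cases hs : 0 < p.eval s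
  · rw [Set.indicator_of_mem (by exact hs), Pi.mul_apply, Pi.one_apply]
    exact ENNReal.mul_inv_cancel (by simpa using hs) (by simp)
  · rw [Set.indicator_of_notMem (by exact hs), Pi.mul_apply, ENNReal.ofReal_of_nonpos (not_lt.mp hs),
      zero_mul]

theorem measure_singleton_eq_zero_of_not_isRoot (hneg : μ {s | p.eval s < 0} = 0)
    (hp : (μ.withDensity fun s => ENNReal.ofReal (p.eval s)) = semicircle) {x : ℝ}
    (hx : ¬ p.IsRoot x) : μ {x} = 0 := by
  rcases lt_or_gt_of_ne (show p.eval x ≠ 0 from hx) with h | h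
  · exact measure_mono_null (by simpa using h) hneg
  · have h1 : semicircle {x} = 0 := measure_singleton x
    rw [← hp, withDensity_apply_eq_zero (by fun_prop)] at h1
    refine measure_mono_null ?_ h1
    rintro s rfl
    simpa using h

/-- The semicircle measure charges every interval `(x, x + ε)` with `-1 < x < 1`, by an amount that
is at least linear in `ε`. -/
theorem exists_mul_le_semicircle_Ioo {x : ℝ} (hx : x ∈ Set.Ioo (-1 : ℝ) 1) :
    ∃ c > 0, ∃ δ > 0, ∀ ε ≤ δ,
      ENNReal.ofReal c * ENNReal.ofReal ε ≤ semicircle (Set.Ioo x (x + ε)) := by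
  have hpos : 0 < 2 / Real.pi * √(1 - x ^ 2) := by
    have : 0 < 1 - x ^ 2 := by nlinarith [hx.1, hx.2]
    positivity
  have hcont : Continuous fun s : ℝ => 2 / Real.pi * √(1 - s ^ 2) := by fun_prop
  have hev : ∀ᶠ s in 𝓝 x, 2 / Real.pi * √(1 - x ^ 2) / 2 < 2 / Real.pi * √(1 - s ^ 2) :=
    hcont.continuousAt.eventually (lt_mem_nhds (by linarith))
  obtain ⟨δ, hδ, hball⟩ := Metric.eventually_nhds_iff.mp
    (hev.and (Ioo_mem_nhds hx.1 hx.2))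
  refine ⟨_, half_pos hpos, δ, hδ, fun ε hε => ?_⟩
  have hmem : ∀ s ∈ Set.Ioo x (x + ε), dist s x < δ := fun s hs => by
    rw [Real.dist_eq, abs_of_pos (by linarith [hs.1])]
    linarith [hs.2]
  have := ofReal_mul_le_semicircle (a := x) (b := x + ε) (c := 2 / Real.pi * √(1 - x ^ 2) / 2)
    (fun s hs => Set.Ioo_subset_Icc_self (hball (hmem s hs)).2)
    (fun s hs => (hball (hmem s hs)).1.le)
  rwa [add_sub_cancel_left] at this

/-- If `p μ = μ_Δ`, then `p` has no zero `x` in `(-1, 1)`: the interval `(x, x + ε)` has measure of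
order `ε` for `μ_Δ`, whereas `p = O(ε)` there, and its measure for `μ` tends to zero. -/
theorem not_isRoot_of_mem_Ioo [IsFiniteMeasure μ]
    (hp : (μ.withDensity fun s => ENNReal.ofReal (p.eval s)) = semicircle) {x : ℝ}
    (hx : x ∈ Set.Ioo (-1 : ℝ) 1) : ¬ p.IsRoot x := by
  intro hroot
  obtain ⟨q, rfl⟩ := dvd_iff_isRoot.mpr hroot
  obtain ⟨c, hc, δ, hδ, hle⟩ := exists_mul_le_semicircle_Ioo hx
  obtain ⟨M, hM⟩ := (isCompact_Icc (a := x) (b := x + δ)).exists_bound_of_continuousOn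
    q.continuous.continuousOn
  have hM0 : 0 ≤ M := (norm_nonneg _).trans (hM x ⟨le_rfl, by linarith⟩)
  have hbound : ∀ ε, 0 < ε → ε ≤ δ →
      ENNReal.ofReal c ≤ ENNReal.ofReal M * μ (Set.Ioo x (x + ε)) := by
    intro ε hε hεδ
    have h1 : semicircle (Set.Ioo x (x + ε)) ≤
        ENNReal.ofReal (ε * M) * μ (Set.Ioo x (x + ε)) := by
      rw [← hp, withDensity_apply _ measurableSet_Ioo, ← setLIntegral_const]
      refine setLIntegral_mono' measurableSet_Ioo fun s hs => ENNReal.ofReal_le_ofReal ?_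
      have h2 := hM s ⟨hs.1.le, by linarith [hs.2]⟩
      have h3 : 0 < s - x := by linarith [hs.1]
      have h4 : s - x ≤ ε := by linarith [hs.2]
      rw [eval_mul, eval_sub, eval_X, eval_C]
      refine (le_abs_self _).trans ?_
      rw [abs_mul, abs_of_pos h3]
      exact mul_le_mul h4 h2 (abs_nonneg _) hε.le
    have h5 := (hle ε hεδ).trans h1
    rw [ENNReal.ofReal_mul hε.le, mul_comm (ENNReal.ofReal c), mul_assoc] at h5
    exact (ENNReal.mul_le_mul_iff_right (by simpa using hε) (by simp)).mp h5
  have hlim : Tendsto (fun k : ℕ => μ (Set.Ioo x (x + δ / (k + 1)))) atTop (𝓝 0) := by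
    have h6 : ⋂ k : ℕ, Set.Ioo x (x + δ / (k + 1)) = ∅ := by
      ext s
      simp only [Set.mem_iInter, Set.mem_empty_iff_false, iff_false, not_forall]
      by_cases hs : x < s
      · obtain ⟨k, hk⟩ := exists_nat_gt (δ / (s - x))
        refine ⟨k, fun h => ?_⟩
        have h7 : 0 < s - x := by linarith
        have h8 : s - x < δ / (k + 1) := by linarith [h.2]
        rw [lt_div_iff₀ (by positivity)] at h8
        rw [div_lt_iff₀ h7] at hk
        nlinarith
      · exact ⟨0, fun h => hs h.1⟩
    rw [← measure_empty (μ := μ), ← h6]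
    refine tendsto_measure_iInter_atTop (fun _ => measurableSet_Ioo.nullMeasurableSet) ?_
      ⟨0, measure_ne_top _ _⟩
    intro i j hij
    refine Set.Ioo_subset_Ioo_right ?_
    gcongr
  have hlim2 := ENNReal.Tendsto.const_mul hlim (Or.inr (ENNReal.ofReal_ne_top (r := M)))
  rw [mul_zero] at hlim2
  have h9 : ENNReal.ofReal c ≤ 0 := by
    refine ge_of_tendsto' hlim2 fun k => hbound _ (by positivity) ?_
    exact div_le_self hδ.le (by linarith [(Nat.cast_nonneg k : (0 : ℝ) ≤ k)])
  simp at h9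
  linarith

theorem ne_zero_of_withDensity_eq_semicircle [IsFiniteMeasure μ]
    (hp : (μ.withDensity fun s => ENNReal.ofReal (p.eval s)) = semicircle) : p ≠ 0 := by
  rintro rfl
  exact not_isRoot_of_mem_Ioo hp (x := 0) (by norm_num) (by simp [IsRoot])

/-- Dividing `p μ = μ_Δ` by `p` recovers `μ` up to the point masses at the roots of `p`. -/
theorem eq_candidateMeasure_of_withDensity_eq [IsFiniteMeasure μ]
    (hneg : μ {s | p.eval s < 0} = 0)
    (hp : (μ.withDensity fun s => ENNReal.ofReal (p.eval s)) = semicircle)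
    (Λ : Finset ℝ) (hΛ : ∀ x ∈ Λ, p.IsRoot x)
    (hΛ' : ∀ x, μ {x} ≠ 0 → x ∈ Λ) :
    μ = candidateMeasure p Λ fun x => (μ {x}).toNNReal := by
  have hN : MeasurableSet {s | 0 < p.eval s} := measurableSet_lt (by fun_prop) (by fun_prop)
  rw [candidateMeasure, withDensity_inv_eq_restrict hp]
  have hz : μ.restrict {s | 0 < p.eval s}ᶜ = μ.restrict (Λ : Set ℝ) := by
    refine Measure.restrict_congr_set (eventuallyLE_antisymm_iff.mpr ⟨?_, ?_⟩)
    · have hroots : μ ((p.roots.toFinset : Set ℝ) \ Λ) = 0 := by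
        refine (measure_null_iff_singleton ((Finset.countable_toSet _).mono Set.sdiff_subset)).mpr ?_
        intro x hx
        by_contra h
        exact hx.2 (hΛ' x h)
      filter_upwards [measure_eq_zero_iff_ae_notMem.mp hneg,
        measure_eq_zero_iff_ae_notMem.mp hroots] with s h1 h2 (h3 : ¬ (0 < p.eval s))
      have h4 : p.eval s = 0 := le_antisymm (not_lt.mp h3) (not_lt.mp h1)
      by_contra h5
      refine h2 ⟨?_, h5⟩
      simpa using ⟨ne_zero_of_withDensity_eq_semicircle hp, h4⟩
    · refine Eventually.of_forall fun s (hs : s ∈ Λ) => ?_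
      have : p.eval s = 0 := hΛ s hs
      change ¬ (0 < p.eval s)
      simp [this]
  have hd : μ.restrict (Λ : Set ℝ) = ∑ x ∈ Λ, μ {x} • Measure.dirac x := by
    ext A hA
    rw [Measure.restrict_apply hA, Measure.finsetSum_apply]
    simp only [Measure.smul_apply, Measure.dirac_apply' _ hA, smul_eq_mul]
    classical
    have : A ∩ (Λ : Set ℝ) = ((Λ.filter (· ∈ A) : Finset ℝ) : Set ℝ) := by
      ext s; simp [and_comm]
    rw [this, ← sum_measure_singleton, Finset.sum_filter]
    refine Finset.sum_congr rfl fun x _ => ?_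
    by_cases hx : x ∈ A <;> simp [hx]
  have hw : ∀ x : ℝ, (((μ {x}).toNNReal : NNReal) : ENNReal) = μ {x} := fun x =>
    ENNReal.coe_toNNReal (measure_ne_top _ _)
  simp only [hw]
  rw [← hd, ← hz, Measure.restrict_add_restrict_compl hN]

end Division

/-! ### The spectral measure of a self-adjoint operator at a vector -/

section SpectralTheorem

variable {H : Type*} [NormedAddCommGroup H] [InnerProductSpace ℂ H] [CompleteSpace H]
  {T : H →L[ℂ] H}

/-- The linear functional `g ↦ ⟨v, g(T) v⟩` on real continuous functions on the spectrum. -/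
def vectorState (hT : IsSelfAdjoint T) (v : H) : C(spectrum ℝ T, ℝ) →ₗ[ℝ] ℝ where
  toFun g := (inner ℂ v (cfcHom hT g v)).re
  map_add' g h := by simp
  map_smul' a g := by
    rw [map_smul, smul_apply, ← Complex.coe_smul a, inner_smul_right]
    simp

theorem ofReal_vectorState (hT : IsSelfAdjoint T) (v : H) (g : C(spectrum ℝ T, ℝ)) :
    (vectorState hT v g : ℂ) = inner ℂ v (cfcHom hT g v) := by
  have hg : IsSelfAdjoint (cfcHom hT g) := cfcHom_predicate hT g
  have h1 := ContinuousLinearMap.isSelfAdjoint_iff_isSymmetric.mp hg v v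
  refine Complex.conj_eq_iff_re.mp ?_
  rw [inner_conj_symm]
  exact h1

theorem vectorState_nonneg (hT : IsSelfAdjoint T) (v : H) {g : C(spectrum ℝ T, ℝ)} (hg : 0 ≤ g) :
    0 ≤ vectorState hT v g := by
  let r : C(spectrum ℝ T, ℝ) := ⟨fun s => √(g s), by fun_prop⟩
  have hr : g = r * r := by
    ext s
    exact (Real.mul_self_sqrt (hg s)).symm
  have hs : IsSelfAdjoint (cfcHom hT r) := cfcHom_predicate hT r
  have h1 := ContinuousLinearMap.isSelfAdjoint_iff_isSymmetric.mp hs v (cfcHom hT r v)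
  change 0 ≤ (inner ℂ v (cfcHom hT g v)).re
  rw [hr, map_mul, mul_apply_eq_comp]
  change inner ℂ (cfcHom hT r v) (cfcHom hT r v) = inner ℂ v (cfcHom hT r (cfcHom hT r v)) at h1
  rw [← h1]
  exact inner_self_nonneg (𝕜 := ℂ)

/-- The Riesz representing measure of `g ↦ ⟨v, g(T) v⟩`, on the spectrum. -/
theorem exists_measure_vectorState (hT : IsSelfAdjoint T) (v : H) :
    ∃ ν : Measure (spectrum ℝ T), IsFiniteMeasure ν ∧
      ∀ g : C(spectrum ℝ T, ℝ), ∫ s, g s ∂ν = vectorState hT v g := by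
  have : CompactSpace (spectrum ℝ T) := isCompact_iff_compactSpace.mp (spectrum.isCompact T)
  let f : CompactlySupportedContinuousMap (spectrum ℝ T) ℝ →ₗ[ℝ] ℝ :=
    { toFun := fun g => vectorState hT v g.toContinuousMap
      map_add' := fun g h => map_add (vectorState hT v) g.toContinuousMap h.toContinuousMap
      map_smul' := fun a g => map_smul (vectorState hT v) a g.toContinuousMap }
  let F := PositiveLinearMap.mk₀ f fun g hg => vectorState_nonneg hT v hg
  refine ⟨RealRMK.rieszMeasure F, inferInstance, fun g => ?_⟩
  exact RealRMK.integral_rieszMeasure F (CompactlySupportedContinuousMap.continuousMapEquiv g)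

theorem cfcHom_aeval (hT : IsSelfAdjoint T) (p : ℝ[X]) :
    cfcHom hT (aeval ((ContinuousMap.id ℝ).restrict (spectrum ℝ T)) p) = aeval T p := by
  have h := Polynomial.aeval_algHom_apply (cfcHom hT).toAlgHom
    ((ContinuousMap.id ℝ).restrict (spectrum ℝ T)) p
  have h2 : (cfcHom hT).toAlgHom ((ContinuousMap.id ℝ).restrict (spectrum ℝ T)) = T := cfcHom_id hT
  rw [h2] at h
  exact h.symm

theorem isSelfAdjoint_aeval (hT : IsSelfAdjoint T) (p : ℝ[X]) : IsSelfAdjoint (aeval T p) := by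
  rw [← cfcHom_aeval hT p]
  exact cfcHom_predicate hT _

/-- `(T - z)⁻¹ = (T - z̄) h(T)` with `h(s) = |s - z|⁻²`. -/
theorem inner_resolvent_eq_integral (hT : IsSelfAdjoint T) (v : H) {ν : Measure (spectrum ℝ T)}
    [IsFiniteMeasure ν] (hν : ∀ g : C(spectrum ℝ T, ℝ), ∫ s, g s ∂ν = vectorState hT v g)
    {z : ℂ} (hz : z ∉ spectrum ℂ T) :
    inner ℂ v (Ring.inverse (T - algebraMap ℂ (H →L[ℂ] H) z) v) =
      ∫ s : spectrum ℝ T, (((s : ℝ) : ℂ) - z)⁻¹ ∂ν := by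
  have : CompactSpace (spectrum ℝ T) := isCompact_iff_compactSpace.mp (spectrum.isCompact T)
  have hne : ∀ s : spectrum ℝ T, ((s : ℝ) - z.re) ^ 2 + z.im ^ 2 ≠ 0 := by
    intro s hs
    apply hz
    have h1 : (s : ℝ) - z.re = 0 := by nlinarith [sq_nonneg ((s : ℝ) - z.re), sq_nonneg z.im]
    have h2 : z.im = 0 := by nlinarith [sq_nonneg ((s : ℝ) - z.re), sq_nonneg z.im]
    have h3 : z = algebraMap ℝ ℂ s := by
      apply Complex.ext
      · simp; linarith
      · simpa using h2
    rw [h3, spectrum.algebraMap_mem_iff]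
    exact s.2
  let ι : C(spectrum ℝ T, ℝ) := (ContinuousMap.id ℝ).restrict (spectrum ℝ T)
  let h : C(spectrum ℝ T, ℝ) := ⟨fun s => (((s : ℝ) - z.re) ^ 2 + z.im ^ 2)⁻¹,
    Continuous.inv₀ (by fun_prop) hne⟩
  let g₁ : C(spectrum ℝ T, ℝ) := (ι - algebraMap ℝ _ z.re) * h
  let g₂ : C(spectrum ℝ T, ℝ) := z.im • h
  have hι : cfcHom hT ι = T := cfcHom_id hT
  have hone : (ι - algebraMap ℝ _ z.re) * ((ι - algebraMap ℝ _ z.re) * h)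
      + (z.im * z.im) • h = 1 := by
    ext s
    have := hne s
    change ((s : ℝ) - z.re) * (((s : ℝ) - z.re) * (((s : ℝ) - z.re) ^ 2 + z.im ^ 2)⁻¹)
      + z.im * z.im * (((s : ℝ) - z.re) ^ 2 + z.im ^ 2)⁻¹ = 1
    field_simp
  have hre : ∀ a : ℝ, algebraMap ℝ (H →L[ℂ] H) a = algebraMap ℂ (H →L[ℂ] H) a := fun a => by
    rw [IsScalarTower.algebraMap_apply ℝ ℂ (H →L[ℂ] H)]
    rfl
  -- `A` and `Q` stand for `T - Re z` and `|T - z|⁻²`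
  set A : H →L[ℂ] H := T - algebraMap ℝ (H →L[ℂ] H) z.re with hA
  set Q := cfcHom hT h with hQ
  have hA' : cfcHom hT (ι - algebraMap ℝ _ z.re) = A := by
    rw [map_sub, hι, AlgHomClass.commutes]
  have hg₁ : cfcHom hT g₁ = A * Q := by rw [map_mul, hA']
  have hg₂ : cfcHom hT g₂ = (z.im : ℂ) • Q := by
    rw [map_smul, Complex.coe_smul]
  have hAQ : A * (A * Q) + ((z.im * z.im : ℝ) : ℂ) • Q = 1 := by
    have := congrArg (cfcHom hT) hone
    rw [map_add, map_mul, map_mul, hA', map_smul, map_one, ← Complex.coe_smul] at this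
    exact this
  have hTz : T - algebraMap ℂ (H →L[ℂ] H) z = A - (z.im * Complex.I) • (1 : H →L[ℂ] H) := by
    have h4 : algebraMap ℂ (H →L[ℂ] H) z
        = algebraMap ℂ (H →L[ℂ] H) z.re + algebraMap ℂ (H →L[ℂ] H) (z.im * Complex.I) := by
      rw [← map_add, Complex.re_add_im]
    rw [h4, hA, hre, Algebra.algebraMap_eq_smul_one (z.im * Complex.I)]
    abel
  set B := cfcHom hT g₁ + Complex.I • cfcHom hT g₂ with hB
  have hinv : (T - algebraMap ℂ (H →L[ℂ] H) z) * B = 1 := by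
    refine Eq.trans ?_ hAQ
    rw [hTz, hB, hg₁, hg₂]
    simp only [sub_mul, mul_add, smul_mul_assoc, one_mul, mul_smul_comm, smul_smul, smul_sub]
    have hI : Complex.I * (z.im : ℂ) * (z.im * Complex.I) = -((z.im * z.im : ℝ) : ℂ) := by
      push_cast
      linear_combination ((z.im : ℂ) * z.im) * Complex.I_sq
    rw [hI, neg_smul, mul_comm (z.im : ℂ) Complex.I]
    abel
  have hunit : IsUnit (T - algebraMap ℂ (H →L[ℂ] H) z) := by
    have := spectrum.notMem_iff.mp hz
    rwa [← IsUnit.neg_iff, neg_sub] at this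
  have hBinv : Ring.inverse (T - algebraMap ℂ (H →L[ℂ] H) z) = B := by
    rw [← mul_one (Ring.inverse _), ← hinv, Ring.inverse_mul_cancel_left _ _ hunit]
  rw [hBinv, hB, add_apply, smul_apply, inner_add_right,
    inner_smul_right, ← ofReal_vectorState, ← ofReal_vectorState, ← hν, ← hν,
    ← integral_complex_ofReal, ← integral_complex_ofReal, ← integral_const_mul, ← integral_add]
  · congr 1 with s
    change ((((s : ℝ) - z.re) * (((s : ℝ) - z.re) ^ 2 + z.im ^ 2)⁻¹ : ℝ) : ℂ)
      + Complex.I * ((z.im * (((s : ℝ) - z.re) ^ 2 + z.im ^ 2)⁻¹ : ℝ) : ℂ) = _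
    have h5 : (((s : ℝ) : ℂ) - z)⁻¹ = (((s : ℝ) - z.re : ℝ) + z.im * Complex.I) *
        (((((s : ℝ) - z.re) ^ 2 + z.im ^ 2 : ℝ)) : ℂ)⁻¹ := by
      have h6 : ((((s : ℝ) - z.re) ^ 2 + z.im ^ 2 : ℝ) : ℂ) =
          (((s : ℝ) : ℂ) - z) * (((s : ℝ) - z.re : ℝ) + z.im * Complex.I) := by
        nth_rewrite 3 [← Complex.re_add_im z]
        push_cast
        linear_combination (z.im : ℂ) ^ 2 * Complex.I_sq
      have h7 : ((((s : ℝ) - z.re) ^ 2 + z.im ^ 2 : ℝ) : ℂ) ≠ 0 := by exact_mod_cast hne s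
      have h8 := h7
      rw [h6] at h8
      rw [h6, mul_inv, mul_comm _ (_⁻¹ * _), mul_assoc, inv_mul_cancel₀ (right_ne_zero_of_mul h8),
        mul_one]
    rw [h5]
    push_cast
    ring
  · exact Continuous.integrable_of_hasCompactSupport (by fun_prop) (.of_compactSpace _)
  · exact Continuous.integrable_of_hasCompactSupport (by fun_prop) (.of_compactSpace _)

/-- The spectral measure of a bounded self-adjoint operator at a vector. -/
theorem exists_spectralMeasure (hT : IsSelfAdjoint T) (v : H) :
    ∃ μ : Measure ℝ, IsFiniteMeasure μ ∧ (∃ K : Set ℝ, IsCompact K ∧ μ Kᶜ = 0) ∧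
      (∀ p : ℝ[X], ((∫ s, p.eval s ∂μ : ℝ) : ℂ) = inner ℂ v (aeval T p v)) ∧
      ∀ z : ℂ, z ∉ spectrum ℂ T →
        inner ℂ v (Ring.inverse (T - algebraMap ℂ (H →L[ℂ] H) z) v) =
          ∫ s : ℝ, ((s : ℂ) - z)⁻¹ ∂μ := by
  obtain ⟨ν, hfin, hν⟩ := exists_measure_vectorState hT v
  have hm : Measurable ((↑) : spectrum ℝ T → ℝ) := measurable_subtype_coe
  have hc : IsCompact (spectrum ℝ T) := spectrum.isCompact T
  have hemb : MeasurableEmbedding ((↑) : spectrum ℝ T → ℝ) :=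
    MeasurableEmbedding.subtype_coe hc.measurableSet
  refine ⟨ν.map (↑), inferInstance, ⟨spectrum ℝ T, hc, ?_⟩, fun p => ?_, fun z hz => ?_⟩
  · rw [Measure.map_apply hm hc.measurableSet.compl]
    simp
  · rw [hemb.integral_map, ← cfcHom_aeval hT p, ← ofReal_vectorState, ← hν]
    simp only [aeval_continuousMap_apply]
    rfl
  · rw [hemb.integral_map, inner_resolvent_eq_integral hT v hν hz]

end SpectralTheorem

/-! ### Eigenvectors and the resolvent -/

section Resolvent

variable {H : Type*} [NormedAddCommGroup H] [InnerProductSpace ℂ H] [CompleteSpace H]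
  {T : H →L[ℂ] H}

theorem notMem_spectrum_of_im_ne_zero (hT : IsSelfAdjoint T) {z : ℂ} (hz : z.im ≠ 0) :
    z ∉ spectrum ℂ T := fun h => hz (by rw [hT.mem_spectrum_eq_re h, Complex.ofReal_im])

/-- If `T u = x u`, then `ε Im ⟨v, (T - x - iε)⁻¹ v⟩ = ‖ε (T - x - iε)⁻¹ v‖²` bounds the squared
component of `v` along `u`, by Cauchy-Schwarz. -/
theorem norm_inner_sq_le_resolvent (hT : IsSelfAdjoint T) {x : ℝ} {u : H} (hu : T u = (x : ℂ) • u)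
    (v : H) {ε : ℝ} (hε : 0 < ε) :
    ‖inner ℂ u v‖ ^ 2 ≤ ‖u‖ ^ 2 * ((ε : ℂ) / Complex.I * inner ℂ v
      (Ring.inverse (T - algebraMap ℂ (H →L[ℂ] H) ((x : ℂ) + Complex.I * (ε : ℂ))) v)).re := by
  set z : ℂ := (x : ℂ) + Complex.I * (ε : ℂ) with hz
  have hzim : z.im = ε := by simp [hz]
  have hsymm : ∀ a b, inner ℂ (T a) b = inner ℂ a (T b) :=
    ContinuousLinearMap.isSelfAdjoint_iff_isSymmetric.mp hT
  have hunit : IsUnit (T - algebraMap ℂ (H →L[ℂ] H) z) := by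
    have := spectrum.notMem_iff.mp (notMem_spectrum_of_im_ne_zero hT (hzim.trans_ne hε.ne'))
    rwa [← IsUnit.neg_iff, neg_sub] at this
  set w := Ring.inverse (T - algebraMap ℂ (H →L[ℂ] H) z) v with hw
  have hv : v = T w - z • w := by
    have h := congrArg (fun S : H →L[ℂ] H => S v) (Ring.mul_inverse_cancel _ hunit)
    simp only [mul_apply_eq_comp, one_apply_eq_self, ← hw] at h
    rw [← h, Algebra.algebraMap_eq_smul_one]
    simp
  have h1 : inner ℂ u v = -(Complex.I * ε) * inner ℂ u w := by
    nth_rewrite 1 [hv]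
    rw [inner_sub_right, ← hsymm, hu, inner_smul_left, inner_smul_right, Complex.conj_ofReal, hz]
    ring
  have h2 : ((ε : ℂ) / Complex.I * inner ℂ v w).re = ε ^ 2 * ‖w‖ ^ 2 := by
    have h3 : ((ε : ℂ) / Complex.I * inner ℂ v w).re = ε * (inner ℂ v w).im := by
      rw [Complex.div_I]
      simp
    have h4 : (inner ℂ (T w) w).im = 0 := by
      have : (starRingEnd ℂ) (inner ℂ (T w) w) = inner ℂ (T w) w := by
        rw [inner_conj_symm, hsymm]
      exact Complex.conj_eq_iff_im.mp this
    rw [h3]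
    nth_rewrite 1 [hv]
    rw [inner_sub_left, inner_smul_left, Complex.sub_im, h4, inner_self_eq_norm_sq_to_K]
    have h5 : ((starRingEnd ℂ) z * ((‖w‖ : ℝ) : ℂ) ^ 2).im = -ε * ‖w‖ ^ 2 := by
      rw [← Complex.ofReal_pow, Complex.im_mul_ofReal, Complex.conj_im, hzim]
    change ε * (0 - ((starRingEnd ℂ) z * ((‖w‖ : ℝ) : ℂ) ^ 2).im) = _
    rw [h5]
    ring
  rw [h2, h1, norm_mul, norm_neg, norm_mul, Complex.norm_I, one_mul, Complex.norm_real,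
    Real.norm_eq_abs, abs_of_pos hε]
  have h6 := norm_inner_le_norm (𝕜 := ℂ) u w
  have h7 : ‖inner ℂ u w‖ ^ 2 ≤ (‖u‖ * ‖w‖) ^ 2 := by gcongr
  calc (ε * ‖inner ℂ u w‖) ^ 2 = ε ^ 2 * ‖inner ℂ u w‖ ^ 2 := by ring
    _ ≤ ε ^ 2 * (‖u‖ * ‖w‖) ^ 2 := by gcongr
    _ = _ := by ring

/-- The spectral measure at `v` charges every eigenvalue whose eigenvector is not orthogonal
to `v`. -/
theorem norm_inner_sq_le_measureReal_singleton (hT : IsSelfAdjoint T) {x : ℝ} {u : H}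
    (hu : T u = (x : ℂ) • u) (v : H) {μ : Measure ℝ} [IsFiniteMeasure μ]
    (hμ : ∀ z : ℂ, z ∉ spectrum ℂ T →
      inner ℂ v (Ring.inverse (T - algebraMap ℂ (H →L[ℂ] H) z) v) = ∫ s : ℝ, ((s : ℂ) - z)⁻¹ ∂μ) :
    ‖inner ℂ u v‖ ^ 2 ≤ ‖u‖ ^ 2 * μ.real {x} := by
  have h1 := (Complex.continuous_re.tendsto _).comp (tendsto_mul_stieltjes (μ := μ) x)
  have h2 := h1.const_mul (‖u‖ ^ 2)
  rw [Complex.ofReal_re] at h2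
  refine ge_of_tendsto h2 ?_
  filter_upwards [self_mem_nhdsWithin] with ε (hε : 0 < ε)
  have h3 := norm_inner_sq_le_resolvent hT hu v hε
  rwa [hμ _ (notMem_spectrum_of_im_ne_zero hT (by simpa using hε.ne'))] at h3

end Resolvent

/-! ### Jacobi operators in coordinates -/

section Coordinates

theorem inner_e_left (k : ℕ) (x : L2) : inner ℂ (e k) x = x k := by
  rw [e, lp.inner_single_left]
  simp

theorem e_apply (i k : ℕ) : (e k : L2) i = if i = k then 1 else 0 := by
  rw [e, lp.single_apply]
  simp [Pi.single_apply]

variable {J : L2 →L[ℂ] L2} {α β : ℕ → ℝ}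

theorem IsJacobi.apply_e_apply (hJ : IsJacobi J α β) (i j : ℕ) :
    J (e j) i = (tridiagonal α β i j : ℂ) := by
  rw [← inner_e_left, hJ.matrix]

theorem tridiagonal_comm (α β : ℕ → ℝ) (i j : ℕ) : tridiagonal α β i j = tridiagonal α β j i := by
  unfold tridiagonal
  split_ifs <;> first | rfl | omega | skip
  all_goals simp_all

theorem IsJacobi.adjoint_apply_e (hJ : IsJacobi J α β) (j : ℕ) :
    ContinuousLinearMap.adjoint J (e j) = J (e j) := by
  ext i
  rw [hJ.apply_e_apply, ← inner_e_left, ContinuousLinearMap.adjoint_inner_right,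
    ← inner_conj_symm, hJ.matrix, Complex.conj_ofReal, tridiagonal_comm]

/-- `J` and its adjoint agree on the basis vectors, hence `⟨e_i, J† x⟩ = ⟨J e_i, x⟩ = ⟨e_i, J x⟩`. -/
theorem IsJacobi.isSelfAdjoint (hJ : IsJacobi J α β) : IsSelfAdjoint J := by
  rw [ContinuousLinearMap.isSelfAdjoint_iff']
  ext x i
  rw [← inner_e_left, ← inner_e_left, ContinuousLinearMap.adjoint_inner_right,
    ← ContinuousLinearMap.adjoint_inner_left, hJ.adjoint_apply_e]

theorem IsJacobi.inner_apply (hJ : IsJacobi J α β) (x y : L2) :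
    inner ℂ (J x) y = inner ℂ x (J y) :=
  ContinuousLinearMap.isSelfAdjoint_iff_isSymmetric.mp hJ.isSelfAdjoint x y

theorem IsJacobi.apply_e_zero (hJ : IsJacobi J α β) :
    J (e 0) = (α 0 : ℂ) • e 0 + (β 0 : ℂ) • e 1 := by
  ext i
  rw [hJ.apply_e_apply]
  simp only [lp.coeFn_add, lp.coeFn_smul, Pi.add_apply, Pi.smul_apply, e_apply, smul_eq_mul,
    tridiagonal]
  rcases i with _ | _ | i <;> simp

theorem IsJacobi.apply_e_succ (hJ : IsJacobi J α β) (k : ℕ) :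
    J (e (k + 1)) = (β k : ℂ) • e k + (α (k + 1) : ℂ) • e (k + 1)
      + (β (k + 1) : ℂ) • e (k + 2) := by
  ext i
  rw [hJ.apply_e_apply]
  simp only [lp.coeFn_add, lp.coeFn_smul, Pi.add_apply, Pi.smul_apply, e_apply, smul_eq_mul,
    tridiagonal]
  by_cases h0 : i = k
  · simp [h0]
  by_cases h1 : i = k + 1
  · simp [h1]
  by_cases h2 : i = k + 2
  · simp [h2]
  simp [h0, h1, h2, Ne.symm h0]

theorem IsJacobi.apply_zero (hJ : IsJacobi J α β) (x : L2) :
    J x 0 = α 0 * x 0 + β 0 * x 1 := by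
  rw [← inner_e_left, ← hJ.inner_apply, hJ.apply_e_zero, inner_add_left, inner_smul_left,
    inner_smul_left, inner_e_left, inner_e_left, Complex.conj_ofReal, Complex.conj_ofReal]

theorem IsJacobi.apply_succ (hJ : IsJacobi J α β) (x : L2) (k : ℕ) :
    J x (k + 1) = β k * x k + α (k + 1) * x (k + 1) + β (k + 1) * x (k + 2) := by
  rw [← inner_e_left, ← hJ.inner_apply, hJ.apply_e_succ, inner_add_left, inner_add_left,
    inner_smul_left, inner_smul_left, inner_smul_left, inner_e_left, inner_e_left, inner_e_left,
    Complex.conj_ofReal, Complex.conj_ofReal, Complex.conj_ofReal]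

theorem aeval_C_mul_apply (a : ℝ) (p : ℝ[X]) (x : L2) :
    aeval J (C a * p) x = (a : ℂ) • aeval J p x := by
  rw [map_mul, aeval_C, Algebra.algebraMap_eq_smul_one, smul_mul_assoc, one_mul]
  rfl

/-- The orthonormal polynomials reproduce the standard basis from `e₀`. -/
theorem IsJacobi.aeval_orthoPoly (hJ : IsJacobi J α β) (k : ℕ) :
    aeval J (orthoPoly α β k) (e 0) = e k := by
  have hX : ∀ p : ℝ[X], aeval J (X * p) (e 0) = J (aeval J p (e 0)) := fun p => by
    rw [map_mul, aeval_X]; rfl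
  have hb : ∀ k, (β k : ℂ) ≠ 0 := fun k => by exact_mod_cast (hJ.pos k).ne'
  induction k using Nat.strong_induction_on with
  | _ k ih =>
    match k with
    | 0 => simp [orthoPoly]
    | 1 =>
      have h := congrArg (fun p => aeval J p (e 0)) (X_mul_orthoPoly_zero α hJ.pos)
      simp only [hX, map_add, add_apply, aeval_C_mul_apply, ih 0 (by omega), hJ.apply_e_zero] at h
      exact (smul_right_injective _ (hb 0) (add_left_cancel h)).symm
    | k + 2 =>
      have h := congrArg (fun p => aeval J p (e 0)) (X_mul_orthoPoly_succ α hJ.pos k)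
      simp only [hX, map_add, add_apply, aeval_C_mul_apply, ih k (by omega),
        ih (k + 1) (by omega), hJ.apply_e_succ] at h
      exact (smul_right_injective _ (hb (k + 1)) (add_left_cancel h)).symm

/-- The orthonormal polynomials are orthonormal for the spectral measure at `e₀`. -/
theorem IsJacobi.integral_orthoPoly_mul (hJ : IsJacobi J α β) {μ : Measure ℝ}
    (hμ : ∀ p : ℝ[X], ((∫ s, p.eval s ∂μ : ℝ) : ℂ) = inner ℂ (e 0) (aeval J p (e 0))) (i j : ℕ) :
    ∫ s, (orthoPoly α β i).eval s * (orthoPoly α β j).eval s ∂μ = if i = j then 1 else 0 := by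
  have h := hμ (orthoPoly α β i * orthoPoly α β j)
  have h1 : inner ℂ (aeval J (orthoPoly α β i) (e 0)) (aeval J (orthoPoly α β j) (e 0)) =
      inner ℂ (e 0 : L2) (aeval J (orthoPoly α β i) (aeval J (orthoPoly α β j) (e 0))) :=
    ContinuousLinearMap.isSelfAdjoint_iff_isSymmetric.mp
      (isSelfAdjoint_aeval hJ.isSelfAdjoint (orthoPoly α β i)) _ _
  rw [map_mul, mul_apply_eq_comp] at h
  rw [hJ.aeval_orthoPoly] at h1
  simp only [eval_mul] at h
  change _ = inner ℂ (e 0 : L2) (aeval J (orthoPoly α β i) (aeval J (orthoPoly α β j) (e 0))) at h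
  rw [← h1, hJ.aeval_orthoPoly, inner_e_left, e_apply] at h
  split_ifs at h ⊢ <;> exact_mod_cast h

/-- A solution of the eigenvalue equation is determined by its first coordinate. -/
theorem IsJacobi.eq_zero_of_apply_zero_eq_zero (hJ : IsJacobi J α β) {z : ℂ} {u : L2}
    (hu : J u = z • u) (h0 : u 0 = 0) : u = 0 := by
  have hb : ∀ k, (β k : ℂ) ≠ 0 := fun k => by exact_mod_cast (hJ.pos k).ne'
  have hk : ∀ k, J u k = z * u k := fun k => by rw [hu]; rfl
  ext k
  change u k = 0
  induction k using Nat.strong_induction_on with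
  | _ k ih =>
    match k with
    | 0 => exact h0
    | 1 =>
      have := hk 0
      rw [hJ.apply_zero, h0, mul_zero, mul_zero, zero_add] at this
      exact (mul_eq_zero.mp this).resolve_left (hb 0)
    | k + 2 =>
      have := hk (k + 1)
      rw [hJ.apply_succ, ih k (by omega), ih (k + 1) (by omega), mul_zero, mul_zero, mul_zero,
        zero_add, zero_add] at this
      exact (mul_eq_zero.mp this).resolve_left (hb (k + 1))

end Coordinates

/-! ### Atoms of the spectral measure -/

section Atoms

variable {J : L2 →L[ℂ] L2} {α β : ℕ → ℝ} {μ : Measure ℝ} [IsFiniteMeasure μ] {R : ℝ}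

/-- Bessel's inequality for the indicator function of `{x}`, where `μ {x} > 0`, against the
orthonormal polynomials. -/
theorem summable_sq_eval_orthoPoly (hsupp : ∀ᵐ s ∂μ, s ∈ Set.Icc (-R) R)
    (hortho : ∀ i j, ∫ s, (orthoPoly α β i).eval s * (orthoPoly α β j).eval s ∂μ =
      if i = j then 1 else 0) {x : ℝ} (hx : μ {x} ≠ 0) :
    Summable fun k => ((orthoPoly α β k).eval x) ^ 2 := by
  have hm : 0 < μ.real {x} := ENNReal.toReal_pos hx (measure_ne_top _ _)
  refine summable_of_sum_range_le (c := (μ.real {x})⁻¹) (fun _ => sq_nonneg _) fun N => ?_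
  set S := ∑ k ∈ Finset.range N, ((orthoPoly α β k).eval x) ^ 2 with hS
  have hS0 : 0 ≤ S := Finset.sum_nonneg fun _ _ => sq_nonneg _
  let q : ℝ[X] := ∑ k ∈ Finset.range N, C ((orthoPoly α β k).eval x) * orthoPoly α β k
  have hq : ∀ s, q.eval s =
      ∑ k ∈ Finset.range N, (orthoPoly α β k).eval x * (orthoPoly α β k).eval s := fun s => by
    simp [q, eval_finsetSum]
  have hqx : q.eval x = S := by
    rw [hq, hS]
    exact Finset.sum_congr rfl fun _ _ => (pow_two _).symm
  have hint : ∫ s, q.eval s ^ 2 ∂μ = S := by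
    have h1 : ∀ s, q.eval s ^ 2 = ∑ i ∈ Finset.range N, ∑ j ∈ Finset.range N,
        (orthoPoly α β i).eval x * (orthoPoly α β j).eval x *
          ((orthoPoly α β i).eval s * (orthoPoly α β j).eval s) := fun s => by
      rw [pow_two, hq, Finset.sum_mul_sum]
      exact Finset.sum_congr rfl fun _ _ => Finset.sum_congr rfl fun _ _ => by ring
    simp only [h1]
    rw [integral_finsetSum _ fun i _ => integrable_of_ae_mem_Icc hsupp (by fun_prop), hS]
    refine Finset.sum_congr rfl fun i hi => ?_
    rw [integral_finsetSum _ fun j _ => integrable_of_ae_mem_Icc hsupp (by fun_prop)]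
    simp only [integral_const_mul, hortho]
    simp only [mul_ite, mul_one, mul_zero, Finset.sum_ite_eq, hi, if_true, pow_two]
  -- the left-hand side is the integral of `q ^ 2` over `{x}` alone
  have hle : μ.real {x} * S ^ 2 ≤ S := by
    have h2 : ∫ s in {x}, q.eval s ^ 2 ∂μ ≤ ∫ s, q.eval s ^ 2 ∂μ :=
      setIntegral_le_integral (integrable_of_ae_mem_Icc hsupp (by fun_prop))
        (Eventually.of_forall fun _ => sq_nonneg _)
    rw [integral_singleton, hqx, hint, smul_eq_mul] at h2
    exact h2
  rcases hS0.eq_or_lt with h | h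
  · rw [← h]; positivity
  · rw [le_inv_comm₀ h hm, ← one_div, le_div_iff₀ h]
    nlinarith

/-- At an atom of the spectral measure, the values of the orthonormal polynomials form an
eigenvector. -/
theorem IsJacobi.exists_eigenvector (hJ : IsJacobi J α β)
    (hsupp : ∀ᵐ s ∂μ, s ∈ Set.Icc (-R) R)
    (hortho : ∀ i j, ∫ s, (orthoPoly α β i).eval s * (orthoPoly α β j).eval s ∂μ =
      if i = j then 1 else 0) {x : ℝ} (hx : μ {x} ≠ 0) :
    ∃ u : L2, u ≠ 0 ∧ J u = (x : ℂ) • u := by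
  have hmem : Memℓp (fun k => (((orthoPoly α β k).eval x : ℝ) : ℂ)) 2 := by
    refine memℓp_gen ?_
    simpa using summable_sq_eval_orthoPoly hsupp hortho hx
  refine ⟨⟨_, hmem⟩, fun h => ?_, ?_⟩
  · have := congrArg (fun u : L2 => u 0) h
    simp [orthoPoly] at this
  · ext k
    cases k with
    | zero =>
      rw [hJ.apply_zero]
      have h := congrArg (eval x) (X_mul_orthoPoly_zero α hJ.pos)
      simp only [eval_mul, eval_add, eval_X, eval_C] at h
      simp only [lp.coeFn_smul, Pi.smul_apply, smul_eq_mul]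
      exact_mod_cast h.symm
    | succ k =>
      rw [hJ.apply_succ]
      have h := congrArg (eval x) (X_mul_orthoPoly_succ α hJ.pos k)
      simp only [eval_mul, eval_add, eval_X, eval_C] at h
      simp only [lp.coeFn_smul, Pi.smul_apply, smul_eq_mul]
      exact_mod_cast h.symm

/-- At the edges `x = ±1` of the continuous spectrum the free recurrence has the solutions `x ^ k`
and `k x ^ k`, so that no nonzero solution tends to zero. -/
theorem eq_zero_of_free_recurrence {x : ℝ} (hx : x ^ 2 = 1) {u : ℕ → ℝ}
    (hu : ∀ k, u (k + 2) = 2 * x * u (k + 1) - u k) (hlim : Tendsto u atTop (𝓝 0)) (k : ℕ) :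
    u k = 0 := by
  -- as `x = x⁻¹`, the recurrence factors: `u (k + 1) - x * u k` is multiplied by `x` at each step
  have hstep : ∀ k, u (k + 2) - x * u (k + 1) = x * (u (k + 1) - x * u k) := fun k => by
    rw [hu k]
    linear_combination u k * hx
  have habs : |x| = 1 := by
    rw [← sq_eq_sq₀ (abs_nonneg x) zero_le_one, sq_abs, hx, one_pow]
  have hconst : ∀ (v : ℕ → ℝ), (∀ k, v (k + 1) = x * v k) → Tendsto v atTop (𝓝 0) →
      ∀ k, v k = 0 := by
    intro v hv hvlim k
    have h1 : ∀ k, |v k| = |v 0| := fun k => by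
      induction k with
      | zero => rfl
      | succ k ih => rw [hv, abs_mul, habs, one_mul, ih]
    have h2 : Tendsto (fun k => |v k|) atTop (𝓝 |0|) := hvlim.abs
    simp only [h1, abs_zero] at h2
    have h3 := tendsto_nhds_unique tendsto_const_nhds h2
    rw [← abs_eq_zero, h1, h3]
  have hd : ∀ k, u (k + 1) - x * u k = 0 := by
    refine hconst (fun k => u (k + 1) - x * u k) hstep ?_
    simpa using ((tendsto_add_atTop_iff_nat 1).mpr hlim).sub (hlim.const_mul x)
  exact hconst u (fun k => sub_eq_zero.mp (hd k)) hlim k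

theorem measure_singleton_eq_zero_of_sq_eq_one (hβ0 : ∀ k, 0 < β k) {m : ℕ}
    (hα : ∀ k, m + 1 ≤ k → α k = 0) (hβ : ∀ k, m ≤ k → β k = 1 / 2)
    (hsupp : ∀ᵐ s ∂μ, s ∈ Set.Icc (-R) R)
    (hortho : ∀ i j, ∫ s, (orthoPoly α β i).eval s * (orthoPoly α β j).eval s ∂μ =
      if i = j then 1 else 0) {x : ℝ} (hx : x ^ 2 = 1) : μ {x} = 0 := by
  by_contra h
  have hsum := summable_sq_eval_orthoPoly hsupp hortho h
  have hlim : Tendsto (fun k => (orthoPoly α β k).eval x) atTop (𝓝 0) := by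
    rw [tendsto_zero_iff_abs_tendsto_zero]
    simpa [Function.comp_def, Real.sqrt_sq_eq_abs] using hsum.tendsto_atTop_zero.sqrt
  have htail : ∀ k, (orthoPoly α β (m + k)).eval x = 0 := by
    refine eq_zero_of_free_recurrence hx (fun k => ?_) ?_
    · have := congrArg (eval x) (orthoPoly_add_two_of_tail hα hβ (Nat.le_add_right m k))
      simp only [eval_mul, eval_sub, eval_X, eval_C] at this
      rw [← add_assoc, this]
      ring_nf
    · simpa only [add_comm m] using (tendsto_add_atTop_iff_nat m).mpr hlim
  -- the recurrence, read downwards, carries the zeros of the tail to all indices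
  have hdown : ∀ d k, m ≤ k + d → (orthoPoly α β k).eval x = 0 := by
    intro d
    induction d with
    | zero =>
      intro k hk
      obtain ⟨j, rfl⟩ := Nat.exists_eq_add_of_le hk
      exact htail j
    | succ d ih =>
      intro k hk
      have h1 := ih (k + 1) (by omega)
      have h2 := ih (k + 2) (by omega)
      have := congrArg (eval x) (X_mul_orthoPoly_succ α hβ0 k)
      simp only [eval_mul, eval_add, eval_X, eval_C, h1, h2, mul_zero, add_zero] at this
      exact (mul_eq_zero.mp this.symm).resolve_left (hβ0 k).ne'
  have := hdown m 0 (by omega)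
  simp [orthoPoly] at this

end Atoms

/-! ### The number of eigenvalues -/

section Counting

variable {J : L2 →L[ℂ] L2} {α β : ℕ → ℝ} {m : ℕ}

theorem hasSum_norm_sq (x : L2) : HasSum (fun k => ‖x k‖ ^ 2) (‖x‖ ^ 2) := by
  simpa using lp.hasSum_norm (p := 2) (by norm_num) x

/-- On vectors supported beyond the perturbed block, `J` acts as the free Jacobi operator, which is
a contraction. -/
theorem IsJacobi.norm_apply_le (hJ : IsJacobi J α β) (hα : ∀ k, m + 1 ≤ k → α k = 0)
    (hβ : ∀ k, m ≤ k → β k = 1 / 2) {v : L2} (hv : ∀ k ≤ m, v k = 0) : ‖J v‖ ^ 2 ≤ ‖v‖ ^ 2 := by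
  have h0 : J v 0 = 1 / 2 * v 1 := by
    rw [hJ.apply_zero, hv 0 (Nat.zero_le m), mul_zero, zero_add]
    rcases Nat.eq_zero_or_pos m with hm | hm
    · rw [hβ 0 hm.le]; norm_num
    · rw [hv 1 hm]; simp
  -- wherever the entries of `J` are not the free ones, they multiply zero coordinates of `v`
  have hs : ∀ k, J v (k + 1) = 1 / 2 * (v k + v (k + 2)) := by
    intro k
    have h1 : (β k : ℂ) * v k = 1 / 2 * v k := by
      rcases le_total m k with hk | hk
      · rw [hβ k hk]; norm_num
      · rw [hv k hk]; simp
    have h2 : (α (k + 1) : ℂ) * v (k + 1) = 0 := by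
      rcases Nat.lt_or_ge m (k + 1) with hk | hk
      · rw [hα (k + 1) hk]; simp
      · rw [hv (k + 1) hk]; simp
    have h3 : (β (k + 1) : ℂ) * v (k + 2) = 1 / 2 * v (k + 2) := by
      rcases le_total m (k + 1) with hk | hk
      · rw [hβ (k + 1) hk]; norm_num
      · rcases hk.eq_or_lt with hk | hk
        · rw [hβ (k + 1) hk.ge]; norm_num
        · rw [hv (k + 2) hk]; simp
    rw [hJ.apply_succ, h1, h2, h3]
    ring
  have hJs := hasSum_norm_sq (J v)
  have hvs := hasSum_norm_sq v
  have hle : ∀ a b : ℂ, ‖1 / 2 * (a + b)‖ ^ 2 ≤ 1 / 2 * (‖a‖ ^ 2 + ‖b‖ ^ 2) := by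
    intro a b
    have h1 : ‖1 / 2 * (a + b)‖ ≤ 1 / 2 * (‖a‖ + ‖b‖) := by
      rw [norm_mul]
      have := norm_add_le a b
      norm_num
      linarith
    nlinarith [norm_nonneg (1 / 2 * (a + b)), sq_nonneg (‖a‖ - ‖b‖), norm_nonneg a, norm_nonneg b]
  have s2 := (summable_nat_add_iff 2).mpr hvs.summable
  have e1 := hJs.summable.tsum_eq_zero_add
  have e2 := hvs.summable.sum_add_tsum_nat_add 2
  have e3 : ∑' k, ‖J v (k + 1)‖ ^ 2 ≤ ∑' k, 1 / 2 * (‖v k‖ ^ 2 + ‖v (k + 2)‖ ^ 2) := by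
    refine Summable.tsum_le_tsum (fun k => ?_) ((summable_nat_add_iff 1).mpr hJs.summable)
      ((hvs.summable.add s2).mul_left _)
    rw [hs]
    exact hle _ _
  rw [tsum_mul_left, hvs.summable.tsum_add s2] at e3
  rw [Finset.sum_range_succ, Finset.sum_range_one] at e2
  rw [hJs.tsum_eq, h0] at e1
  rw [hvs.tsum_eq] at e2 e3
  have h4 := hle (v 1) 0
  rw [add_zero, norm_zero] at h4
  have h5 := sq_nonneg ‖v 0‖
  have h6 := sq_nonneg ‖v 1‖
  rw [e1]
  nlinarith

/-- There are at most `m + 1` eigenvalues outside `[-1, 1]`: a larger number of eigenvectors has a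
nontrivial combination `v` vanishing on the perturbed block, and then both `‖J v‖ ≤ ‖v‖` and, by
orthogonality, `‖J v‖ > ‖v‖`. -/
theorem IsJacobi.card_eigenvalues_le (hJ : IsJacobi J α β) (hα : ∀ k, m + 1 ≤ k → α k = 0)
    (hβ : ∀ k, m ≤ k → β k = 1 / 2) (Λ : Finset ℝ)
    (hΛ : ∀ x ∈ Λ, 1 < x ^ 2 ∧ ∃ u : L2, u ≠ 0 ∧ J u = (x : ℂ) • u) : Λ.card ≤ m + 1 := by
  by_contra! hcard
  choose hsq u hu0 hu using fun x : Λ => hΛ x x.2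
  let f : (Λ → ℂ) →ₗ[ℂ] (Fin (m + 1) → ℂ) :=
    { toFun := fun c i => ∑ x, c x * u x i
      map_add' := fun c d => by ext i; simp [add_mul, Finset.sum_add_distrib]
      map_smul' := fun a c => by ext i; simp [Finset.mul_sum, mul_assoc] }
  obtain ⟨c, hc, hc0⟩ := (Submodule.ne_bot_iff _).mp
    (LinearMap.ker_ne_bot_of_finrank_lt (f := f) (by simpa using hcard))
  have horth : ∀ x y : Λ, x ≠ y → inner ℂ (u x) (u y) = 0 := by
    intro x y hxy
    have h := hJ.inner_apply (u x) (u y)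
    rw [hu, hu, inner_smul_left, inner_smul_right, Complex.conj_ofReal, ← sub_eq_zero,
      ← sub_mul] at h
    refine (mul_eq_zero.mp h).resolve_left ?_
    exact sub_ne_zero.mpr fun h => hxy (Subtype.ext (Complex.ofReal_injective h))
  have hnorm : ∀ a : Λ → ℂ, ‖∑ x, a x • u x‖ ^ 2 = ∑ x, ‖a x‖ ^ 2 * ‖u x‖ ^ 2 := by
    intro a
    have h : inner ℂ (∑ x, a x • u x) (∑ x, a x • u x) =
        ((∑ x, ‖a x‖ ^ 2 * ‖u x‖ ^ 2 : ℝ) : ℂ) := by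
      rw [sum_inner]
      push_cast
      refine Finset.sum_congr rfl fun x _ => ?_
      rw [inner_sum, Finset.sum_eq_single x]
      · rw [inner_smul_left, inner_smul_right, inner_self_eq_norm_sq_to_K, ← mul_assoc,
          Complex.conj_mul']
        rfl
      · intro y _ hy
        rw [inner_smul_left, inner_smul_right, horth x y hy.symm, mul_zero, mul_zero]
      · simp
    rw [inner_self_eq_norm_sq_to_K] at h
    change ((‖∑ x, a x • u x‖ : ℝ) : ℂ) ^ 2 = _ at h
    exact_mod_cast h
  set v : L2 := ∑ x, c x • u x with hv
  have hvk : ∀ k ≤ m, v k = 0 := by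
    intro k hk
    have h := congrFun hc ⟨k, Nat.lt_succ_of_le hk⟩
    rw [← inner_e_left, hv, inner_sum]
    simp only [inner_smul_right, inner_e_left]
    exact h
  have hJv : J v = ∑ x, (c x * (x : ℝ)) • u x := by
    rw [hv, map_sum]
    refine Finset.sum_congr rfl fun x _ => ?_
    rw [map_smul, hu, smul_smul]
  have hle := hJ.norm_apply_le hα hβ hvk
  rw [hJv, hv, hnorm, hnorm] at hle
  obtain ⟨x₀, hx₀⟩ : ∃ x, c x ≠ 0 := by
    by_contra! h
    exact hc0 (funext h)
  refine absurd hle (not_le.mpr (Finset.sum_lt_sum (fun x _ => ?_) ⟨x₀, Finset.mem_univ _, ?_⟩))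
  · rw [norm_mul, mul_pow, Complex.norm_real, Real.norm_eq_abs, sq_abs, mul_right_comm]
    exact le_mul_of_one_le_right (by positivity) (hsq x).le
  · rw [norm_mul, mul_pow, Complex.norm_real, Real.norm_eq_abs, sq_abs, mul_right_comm]
    have h1 := norm_pos_iff.mpr hx₀
    have h2 := norm_pos_iff.mpr (hu0 x₀)
    exact lt_mul_of_one_lt_right (by positivity) (hsq x₀)

end Counting

/-! ### The identity between the two measures -/

/-- `p_C μ = μ_Δ` on polynomials: `∫ P_j p_C dμ = c_{0j} = ∫ P_j dμ_Δ` holds for all `j`, since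
`c_{0j} = 0` for `j ≥ 2n`. -/
theorem integral_mul_pC {α β : ℕ → ℝ} (hβ0 : ∀ k, 0 < β k) {m : ℕ}
    (hα : ∀ k, m + 1 ≤ k → α k = 0) (hβ : ∀ k, m ≤ k → β k = 1 / 2)
    {μ : Measure ℝ} [IsFiniteMeasure μ] {R : ℝ} (hsupp : ∀ᵐ s ∂μ, s ∈ Set.Icc (-R) R)
    (hortho : ∀ i j, ∫ s, (orthoPoly α β i).eval s * (orthoPoly α β j).eval s ∂μ =
      if i = j then 1 else 0) (q : ℝ[X]) :
    ∫ s, q.eval s * (pC α β (m + 1)).eval s ∂μ = ∫ s, q.eval s ∂semicircle := by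
  rw [integral_semicircle_eq_chebCoeff]
  let f : ℝ[X] →ₗ[ℝ] ℝ :=
    { toFun := fun q => ∫ s, q.eval s * (pC α β (m + 1)).eval s ∂μ
      map_add' := fun q r => by
        simp only [eval_add, add_mul]
        exact integral_add (integrable_of_ae_mem_Icc hsupp (by fun_prop))
          (integrable_of_ae_mem_Icc hsupp (by fun_prop))
      map_smul' := fun a q => by simp [integral_const_mul, mul_assoc] }
  have : f = chebCoeff 0 := linearMap_ext_orthoPoly α hβ0 fun j => by
    change ∫ s, (orthoPoly α β j).eval s * (pC α β (m + 1)).eval s ∂μ = _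
    have h1 : ∀ s, (orthoPoly α β j).eval s * (pC α β (m + 1)).eval s =
        ∑ k ∈ Finset.range (2 * (m + 1)), chebCoeff 0 (orthoPoly α β k) *
          ((orthoPoly α β j).eval s * (orthoPoly α β k).eval s) := fun s => by
      simp only [pC, eval_finsetSum, eval_mul, eval_C, connectionCoeff_free, Finset.mul_sum]
      exact Finset.sum_congr rfl fun _ _ => by ring
    simp only [h1]
    rw [integral_finsetSum _ fun k _ => integrable_of_ae_mem_Icc hsupp (by fun_prop)]
    simp only [integral_const_mul, hortho, mul_ite, mul_one, mul_zero, Finset.sum_ite_eq,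
      Finset.mem_range]
    split_ifs with hj
    · rfl
    · exact (chebCoeff_zero_orthoPoly_of_tail hα hβ (not_lt.mp hj)).symm
  exact LinearMap.congr_fun this q

/-- A bounded self-adjoint operator has at most one spectral measure. -/
theorem IsSpectralMeasure.unique {J : L2 →L[ℂ] L2} (hJ : IsSelfAdjoint J) {μ ν : Measure ℝ}
    (hμ : IsSpectralMeasure J μ) (hν : IsSpectralMeasure J ν) : μ = ν := by
  have := hμ.prob
  have := hν.prob
  obtain ⟨R₁, -, h₁⟩ := exists_support_subset_Icc hμ.compact_support
  obtain ⟨R₂, -, h₂⟩ := exists_support_subset_Icc hν.compact_support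
  refine measure_eq_of_stieltjes_eq (R := max R₁ R₂) ?_ ?_ fun z hz => ?_
  · filter_upwards [h₁] with s hs
    exact Set.Icc_subset_Icc (neg_le_neg (le_max_left _ _)) (le_max_left _ _) hs
  · filter_upwards [h₂] with s hs
    exact Set.Icc_subset_Icc (neg_le_neg (le_max_right _ _)) (le_max_right _ _) hs
  · rw [← hμ.stieltjes z (notMem_spectrum_of_im_ne_zero hJ hz),
      ← hν.stieltjes z (notMem_spectrum_of_im_ne_zero hJ hz)]

end Jacobi
end

theorem theorem4p8 (J : Jacobi.L2 →L[ℂ] Jacobi.L2) (α β : ℕ → ℝ) (hJ : Jacobi.IsJacobi J α β)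
    (n : ℕ) (hn : 1 ≤ n) (hα : ∀ k, n ≤ k → α k = 0) (hβ : ∀ k, n ≤ k → β (k - 1) = 1 / 2) :
    ∃ (Λ : Finset ℝ) (w : ℝ → NNReal),
      -- at each real root of `p_C` other than `±1` the limit defining the weight exists
      (∀ x : ℝ, (Jacobi.pC α β n).IsRoot x → x ≠ 1 → x ≠ -1 →
        Filter.Tendsto
          (fun ε : ℝ => (ε : ℂ) / Complex.I *
            Jacobi.principalResolvent J ((x : ℂ) + Complex.I * (ε : ℂ)))
          (nhdsWithin 0 (Set.Ioi 0)) (nhds (((w x : NNReal) : ℝ) : ℂ))) ∧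
      -- `Λ = {λ₁, …, λ_r}` is the set of those roots where it is not zero
      (∀ x : ℝ, x ∈ Λ ↔ (Jacobi.pC α β n).IsRoot x ∧ x ≠ 1 ∧ x ≠ -1 ∧ w x ≠ 0) ∧
      -- the spectral measure of `J` exists, is unique, and is given by the formula
      (∀ μ : MeasureTheory.Measure ℝ, Jacobi.IsSpectralMeasure J μ ↔
        μ = Jacobi.candidateMeasure (Jacobi.pC α β n) Λ w) ∧
      -- no roots inside `(-1, 1)`
      (∀ x ∈ Set.Ioo (-1 : ℝ) 1, ¬ (Jacobi.pC α β n).IsRoot x) ∧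
      -- `λ₁, …, λ_r` are the eigenvalues of `J`, and there are at most `n` of them
      (∀ z : ℂ, Module.End.HasEigenvalue (J : Jacobi.L2 →ₗ[ℂ] Jacobi.L2) z ↔
        ∃ x ∈ Λ, z = (x : ℂ)) ∧
      Λ.card ≤ n := by
  open Jacobi MeasureTheory Filter in
  -- the off-diagonal entries are already free from index `n - 1` on, whence the shift `n = m + 1`
  obtain ⟨m, rfl⟩ : ∃ m, n = m + 1 := ⟨n - 1, by omega⟩
  have hβ' : ∀ k, m ≤ k → β k = 1 / 2 := fun k hk => hβ (k + 1) (by omega)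
  obtain ⟨μ, hfin, hK, hmom, hres⟩ := exists_spectralMeasure hJ.isSelfAdjoint (e 0)
  obtain ⟨R, -, hsupp⟩ := exists_support_subset_Icc hK
  have hortho := hJ.integral_orthoPoly_mul hmom
  have hspec : IsSpectralMeasure J μ := by
    refine ⟨⟨?_⟩, hK, hres⟩
    have h := hortho 0 0
    simp only [orthoPoly, Polynomial.eval_one, mul_one, integral_const, smul_eq_mul, if_true] at h
    rwa [measureReal_def, ENNReal.toReal_eq_one_iff] at h
  obtain ⟨hneg, hp⟩ := withDensity_eq_semicircle hsupp
    (integral_mul_pC hJ.pos hα hβ' hsupp hortho)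
  have hp0 := ne_zero_of_withDensity_eq_semicircle hp
  have hw : ∀ x : ℝ, (μ {x}).toNNReal ≠ 0 ↔ μ {x} ≠ 0 := fun x => by
    rw [Ne, ENNReal.toNNReal_eq_zero_iff]
    simp [measure_ne_top]
  have hedge : ∀ x : ℝ, x ^ 2 = 1 → μ {x} = 0 := fun x hx =>
    measure_singleton_eq_zero_of_sq_eq_one hJ.pos hα hβ' hsupp hortho hx
  have hatom : ∀ x : ℝ, μ {x} ≠ 0 → (pC α β (m + 1)).IsRoot x ∧ x ≠ 1 ∧ x ≠ -1 := by
    refine fun x hx => ⟨?_, ?_, ?_⟩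
    · by_contra h
      exact hx (measure_singleton_eq_zero_of_not_isRoot hneg hp h)
    · rintro rfl
      exact hx (hedge 1 (by norm_num))
    · rintro rfl
      exact hx (hedge (-1) (by norm_num))
  classical
  let Λ : Finset ℝ := (pC α β (m + 1)).roots.toFinset.filter fun x => μ {x} ≠ 0
  have hΛ : ∀ x, x ∈ Λ ↔ μ {x} ≠ 0 := fun x => by
    simp only [Λ, Finset.mem_filter, Multiset.mem_toFinset, Polynomial.mem_roots hp0,
      and_iff_right_iff_imp]
    exact fun hx => (hatom x hx).1
  have hroots := fun (x : ℝ) (hx : x ∈ Set.Ioo (-1 : ℝ) 1) => not_isRoot_of_mem_Ioo hp hx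
  -- the weights are the point masses of the spectral measure
  refine ⟨Λ, fun x => (μ {x}).toNNReal, fun x _ _ _ => ?_, fun x => ?_, fun ρ => ?_, hroots,
    fun z => ?_, ?_⟩
  · refine (tendsto_mul_stieltjes (μ := μ) x).congr' ?_
    filter_upwards [self_mem_nhdsWithin] with ε (hε : 0 < ε)
    rw [hspec.stieltjes _
      (notMem_spectrum_of_im_ne_zero hJ.isSelfAdjoint (by simpa using hε.ne'))]
  · rw [hw, hΛ]
    exact ⟨fun h => ⟨(hatom x h).1, (hatom x h).2.1, (hatom x h).2.2, h⟩, fun h => h.2.2.2⟩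
  · rw [← eq_candidateMeasure_of_withDensity_eq hneg hp Λ
      (fun x hx => (hatom x ((hΛ x).mp hx)).1) (fun x hx => (hΛ x).mpr hx)]
    exact ⟨fun h => h.unique hJ.isSelfAdjoint hspec, fun h => h ▸ hspec⟩
  · constructor
    · intro hz
      obtain ⟨u, hu⟩ := hz.exists_hasEigenvector
      have hu1 : J u = z • u := hu.apply_eq_smul
      have hreal : (z.re : ℂ) = z := by
        have hsymm : (J : L2 →ₗ[ℂ] L2).IsSymmetric :=
          ContinuousLinearMap.isSelfAdjoint_iff_isSymmetric.mp hJ.isSelfAdjoint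
        exact Complex.conj_eq_iff_re.mp (hsymm.conj_eigenvalue_eq_self hz)
      refine ⟨z.re, (hΛ _).mpr fun h0 => hu.2 (hJ.eq_zero_of_apply_zero_eq_zero hu1 ?_), hreal.symm⟩
      rw [← hreal] at hu1
      have h := norm_inner_sq_le_measureReal_singleton hJ.isSelfAdjoint hu1 (e 0) hres
      rw [measureReal_def, h0, ENNReal.toReal_zero, mul_zero] at h
      have h1 : inner ℂ u (e 0) = 0 := by
        rw [← norm_eq_zero]
        nlinarith [norm_nonneg (inner ℂ u (e 0))]
      rw [← inner_e_left, inner_eq_zero_symm]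
      exact h1
    · rintro ⟨x, hx, rfl⟩
      obtain ⟨u, hu0, hu⟩ := hJ.exists_eigenvector hsupp hortho ((hΛ x).mp hx)
      exact Module.End.hasEigenvalue_of_hasEigenvector
        ⟨Module.End.mem_eigenspace_iff.mpr hu, hu0⟩
  · refine hJ.card_eigenvalues_le hα hβ' Λ fun x hx => ?_
    have hx' := (hΛ x).mp hx
    refine ⟨?_, hJ.exists_eigenvector hsupp hortho hx'⟩
    by_contra! h
    rcases h.lt_or_eq with h | h
    · exact hroots x (abs_lt.mp ((sq_lt_one_iff_abs_lt_one x).mp h)) (hatom x hx').1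
    · exact hx' (hedge x h)
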